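/- Let $\mathbb S^1=\{|\lambda|=1\}$ and $\mathbb D=\{|\lambda|<1\}$ in $\mathbb C$. Let $M_1,\dots,M_n:\mathbb S^1\to \mathrm{GL}_2(\mathbb C)$ be analytic maps. Suppose that the set $\{M_1,\dots,M_n\}$ is nondegenerate, i.e. for some $i\neq j$ the commutator $[M_i,M_j]$ is not identically zero on $\mathbb S^1$, and that it is simultaneously unitarizable pointwise on $\mathbb S^1$ except possibly at a finite set, i.e. for all but finitely many $\lambda\in\mathbb S^1$ there is a matrix $P\in \mathrm{GL}_2(\mathbb C)$ such that $P\,M_k(\lambda)\,P^{-1}\in \mathrm U_2$ for all $k$. Let $\mathcal G$ be the set of analytic maps $C:\mathbb S^1\to \mathrm M_{2\times 2}(\mathbb C)$ such that 1. $C$ is the boundary of a holomorphic map $\widetilde C:\mathbb D\to \mathrm{GL}_2(\mathbb C)$, i.e. $C$ and $\widetilde C$ together form a continuous map on $\overline{\mathbb D}$, and $\widetilde C(0)$ is upper triangular with positive real diagonal entries; 2. for every $k$, the map $C M_k C^{-1}$, defined where $\det C\ne 0$, extends analytically across $\{\det C=0\}$ to an analytic map $\mathbb S^1\to \mathrm U_2$.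 Then $\mathcal G$ is nonempty, and its elements are unique up to multiplication by scalar functions in the following sense. (a) If $C_1,C_2\in\mathcal G$, then $\widetilde C_2=g\,\widetilde C_1$ on $\mathbb D$ for some holomorphic $g:\mathbb D\to\mathbb C\setminus\{0\}$. (b) There is a $C\in\mathcal G$ such that every $C'\in\mathcal G$ is of the form $C'=fC$ on $\mathbb S^1$, where $f:\mathbb S^1\to\mathbb C$ is an analytic function which is the boundary of a holomorphic function $\mathbb D\to\mathbb C\setminus\{0\}$ ($f$ may have zeros on $\mathbb S^1$). -/

import Mathlib

namespace GluingTheorem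

/-- The unit circle in the complex plane. A loop is a function on the plane of which only the
values on this set matter. -/
abbrev unitCircle : Set ℂ := Metric.sphere 0 1

/-- The open unit disk. -/
abbrev unitDisk : Set ℂ := Metric.ball 0 1

/-- The space of complex two by two matrices. -/
abbrev Mat2 : Type := Matrix (Fin 2) (Fin 2) ℂ

/-- Analytic map from the unit circle to matrices: around every point of the circle, every entry
is given on the circle by a convergent power series. -/
def IsAnalyticLoop (X : ℂ → Mat2) : Prop :=
  ∀ i j, AnalyticOn ℂ (fun z => X z i j) unitCircle

/-- The family is nondegenerate: two of its members do not commute. -/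
def Nondegenerate {ι : Type*} (A : ι → Mat2) : Prop :=
  ∃ i j, i ≠ j ∧ A i * A j - A j * A i ≠ 0

/-- One invertible matrix conjugates all members of the family into the unitary group. -/
def SimultaneouslyUnitarizable {ι : Type*} (A : ι → Mat2) : Prop :=
  ∃ C : Matrix.GeneralLinearGroup (Fin 2) ℂ, ∀ j,
    (C : Mat2) * A j * ((C⁻¹ : Matrix.GeneralLinearGroup (Fin 2) ℂ) : Mat2)
      ∈ Matrix.unitaryGroup (Fin 2) ℂ

/-- Upper triangular with positive real diagonal entries. -/
def IsPosUpperTriangular (T : Mat2) : Prop :=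
  T 1 0 = 0 ∧ ∀ i, 0 < (T i i).re ∧ (T i i).im = 0

/-- `X` is the boundary of `F`, where `F` is a holomorphic map from the open unit disk to
invertible matrices, continuous up to the circle, with `F 0` upper triangular with positive
diagonal. -/
structure IsBoundaryOf (X F : ℂ → Mat2) : Prop where
  diffContOnCl : ∀ i j, DiffContOnCl ℂ (fun z => F z i j) unitDisk
  det_ne_zero : ∀ z ∈ unitDisk, (F z).det ≠ 0
  pos : IsPosUpperTriangular (F 0)
  boundary : Set.EqOn F X unitCircle

/-- Analytic maps from the unit circle to matrices that are the boundary of a holomorphic map from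
the disk to invertible matrices with positive upper triangular value at the origin. -/
def IsPositiveLoop (X : ℂ → Mat2) : Prop :=
  IsAnalyticLoop X ∧ ∃ F, IsBoundaryOf X F

/-- The loop is analytic and takes unitary values on the unit circle. -/
def IsUnitaryLoop (N : ℂ → Mat2) : Prop :=
  IsAnalyticLoop N ∧ ∀ z ∈ unitCircle, N z ∈ Matrix.unitaryGroup (Fin 2) ℂ

/-- Every `C * M k * C⁻¹`, which is defined where `det C ≠ 0`, extends to a unitary loop. -/
def ConjugatesToUnitary {ι : Type*} (M : ι → ℂ → Mat2) (C : ℂ → Mat2) : Prop :=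
  ∀ k, ∃ N : ℂ → Mat2, IsUnitaryLoop N ∧
    ∀ z ∈ unitCircle, (C z).det ≠ 0 → N z = C z * M k z * (C z)⁻¹

/-- A positive loop that simultaneously unitarizes the loops `M k`. -/
def IsGluing {ι : Type*} (M : ι → ℂ → Mat2) (C : ℂ → Mat2) : Prop :=
  IsPositiveLoop C ∧ ConjugatesToUnitary M C

/-- Analytic scalar functions on the unit circle that are the boundary of a holomorphic
nowhere vanishing function on the open unit disk. Zeros on the circle are allowed. -/
def IsScalarFactor (f : ℂ → ℂ) : Prop :=
  AnalyticOn ℂ f unitCircle ∧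
    ∃ g : ℂ → ℂ, DiffContOnCl ℂ g unitDisk ∧ (∀ z ∈ unitDisk, g z ≠ 0) ∧ Set.EqOn g f unitCircle

end GluingTheorem

/-!
The loops `M k` are unitarized pointwise by the square roots of their invariant Hermitian forms, so
the theorem is a statement about one matrix valued function. Call a positive definite `X` invariant
under `A` if `Aᴴ X A = X`. If `C` is invertible, then `C A C⁻¹` is unitary exactly when `Cᴴ C` is
invariant under `A`. When two of the matrices do not commute, the invariant form is unique up to a
positive factor, and it is given by an algebraic formula in these two matrices and their conjugate
transposes (`intertwiner`). The formula depends analytically on the point of the circle, so that an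
analytic loop `X` of positive semidefinite matrices with `det X ≢ 0` arises which is invariant under
all `M k` at all but finitely many points (`exists_invariant_loop`).

*Existence* is spectral factorization: `X = Yᴴ Y` on the circle, with `Y` holomorphic near the
closed disk and invertible in the open disk (`exists_factor_of_posSemidef`). The zeros of `det X` on
the circle are split off one by one by factors `diag (z - z₀, 1)`. For a positive definite loop
(`exists_factor_of_posDef`), scalar factorizations of a diagonal entry and of the determinant reduce
the problem to a unipotent loop with one holomorphic and one antiholomorphic off-diagonal part, and
factoring the latter amounts to solving a linear equation with operator `1 + W Wᴴ` on `ℓ²`, where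
`W` is the Hankel operator of the off-diagonal entry (`exists_factor_unipotent`). Dividing `Y` by
the common zeros of its entries on the circle (`exists_primitive`) and multiplying it by a constant
unitary matrix gives `C`. Since `C M_k C⁻¹` is unitary, hence bounded, off a finite set, it extends
across the zeros of `det C` (`conjugatesToUnitary_of_invariant`).

*Uniqueness*: the holomorphic extensions `F₁`, `F₂` of two gluings have proportional Hermitian
squares on the circle, so that `K = F₂ adj F₁` is there a multiple of a unitary matrix. The
functions `K_ij K_kl / det K` are then bounded, and suitable combinations of them are real on the
circle, hence constant in the disk; evaluation at the origin, where both `F_i` are upper triangular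
with positive diagonal, shows that `K` is scalar (`exists_eq_smul_of_proportional`). If the entries
of the first gluing have no common zero on the circle, then the scalar quotient is analytic there
(`exists_scalarFactor`).
-/

namespace GluingTheorem

open Complex Metric Set Filter Topology
open scoped ComplexConjugate

/-! ### Analytic functions on the unit circle -/

lemma mem_unitCircle {z : ℂ} : z ∈ unitCircle ↔ ‖z‖ = 1 := by simp [unitCircle]

lemma ne_zero_of_mem_unitCircle {z : ℂ} (hz : z ∈ unitCircle) : z ≠ 0 := by
  rintro rfl
  simp at hz

lemma mul_conj_of_mem_unitCircle {z : ℂ} (hz : z ∈ unitCircle) : z * conj z = 1 := by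
  rw [mul_conj, normSq_eq_norm_sq, mem_unitCircle.1 hz]
  simp

lemma conj_inv_of_mem_unitCircle {z : ℂ} (hz : z ∈ unitCircle) : (conj z)⁻¹ = z :=
  inv_eq_of_mul_eq_one_left (mul_conj_of_mem_unitCircle hz)

lemma isPreconnected_unitCircle : IsPreconnected unitCircle :=
  isPreconnected_sphere (by simp [Complex.rank_real_complex]) 0 1

lemma frequently_mem_unitCircle_diff {x : ℂ} (hx : x ∈ unitCircle) {T : Set ℂ} (hT : T.Finite) :
    ∃ᶠ y in 𝓝[≠] x, y ∈ unitCircle \ T := by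
  have hnt : unitCircle.Nontrivial :=
    ⟨1, by simp, -1, by simp, by norm_num [Complex.ext_iff]⟩
  have h1 := isPreconnected_unitCircle.preperfect_of_nontrivial hnt x hx
  rw [accPt_iff_frequently_nhdsNE] at h1
  have h2 : ∀ᶠ y in 𝓝[≠] x, y ∉ T := by
    have : (T \ {x})ᶜ ∈ 𝓝 x := (hT.subset sdiff_subset).isClosed.isOpen_compl.mem_nhds (by simp)
    filter_upwards [nhdsWithin_le_nhds this, self_mem_nhdsWithin] with y hy hne hyT
    exact hy ⟨hyT, hne⟩
  exact (h1.and_eventually h2).mono fun y hy => hy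

/-- Closed conditions on a continuous function on the circle may be checked off a finite set. -/
lemma mem_of_finite_exception {Y : Type*} [TopologicalSpace Y] {F : ℂ → Y} {K : Set Y}
    (hF : ContinuousOn F unitCircle) (hK : IsClosed K) {T : Set ℂ} (hT : T.Finite)
    (h : ∀ z ∈ unitCircle \ T, F z ∈ K) {z : ℂ} (hz : z ∈ unitCircle) : F z ∈ K := by
  have hne : (𝓝[unitCircle \ T] z).NeBot := by
    rw [← mem_closure_iff_nhdsWithin_neBot, mem_closure_iff_frequently]
    exact (frequently_mem_unitCircle_diff hz hT).filter_mono nhdsWithin_le_nhds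
  have ht : Tendsto F (𝓝[unitCircle \ T] z) (𝓝 (F z)) := (hF z hz).mono_left
    (nhdsWithin_mono _ sdiff_subset)
  exact hK.mem_of_tendsto ht (by filter_upwards [self_mem_nhdsWithin] with y hy using h y hy)

lemma eqOn_of_finite_exception {Y : Type*} [TopologicalSpace Y] [T2Space Y] {f g : ℂ → Y}
    (hf : ContinuousOn f unitCircle) (hg : ContinuousOn g unitCircle) {T : Set ℂ} (hT : T.Finite)
    (h : ∀ z ∈ unitCircle \ T, f z = g z) : EqOn f g unitCircle := fun _ hz =>
  mem_of_finite_exception (F := fun z => (f z, g z)) (hf.prodMk hg) isClosed_diagonal hT h hz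

lemma exists_mem_unitCircle_diff {T : Set ℂ} (hT : T.Finite) : ∃ z, z ∈ unitCircle \ T :=
  (frequently_mem_unitCircle_diff (x := 1) (by simp) hT).exists

lemma eqOn_unitCircle_of_frequently {f g : ℂ → ℂ} {x : ℂ} {U : Set ℂ} (hU : IsPreconnected U)
    (hf : AnalyticOnNhd ℂ f U) (hg : AnalyticOnNhd ℂ g U) (hx : x ∈ unitCircle) (hxU : x ∈ U)
    (h : EqOn f g unitCircle) : EqOn f g U :=
  hf.eqOn_of_preconnected_of_frequently_eq hg hU hxU
    ((frequently_mem_unitCircle_diff hx finite_empty).mono fun _ hy => h hy.1)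

/-- An analytic function on the circle is the restriction of a function that is holomorphic near
the circle. The local extensions have a common radius by Lebesgue's number lemma, and they agree by
the identity theorem, so they can be glued along rays. -/
lemma exists_analyticOnNhd_extension {f : ℂ → ℂ} (hf : AnalyticOn ℂ f unitCircle) :
    ∃ E : ℂ → ℂ, AnalyticOnNhd ℂ E unitCircle ∧ EqOn E f unitCircle := by
  have h1 : ∀ x : unitCircle, ∃ g : ℂ → ℂ, EqOn f g unitCircle ∧ AnalyticAt ℂ g x := by
    rintro ⟨x, hx⟩
    obtain ⟨g, -, h2, h3⟩ := analyticWithinAt_iff_exists_analyticAt'.1 (hf x hx)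
    exact ⟨g, h2.mono (subset_insert _ _), h3⟩
  choose g hg hga using h1
  obtain ⟨δ, hδ, hc⟩ := lebesgue_number_lemma_of_metric (s := unitCircle)
    (c := fun x : unitCircle => {y | AnalyticAt ℂ (g x) y}) (isCompact_sphere 0 1)
    (fun x => isOpen_analyticAt ℂ (g x)) (fun x hx => mem_iUnion.2 ⟨⟨x, hx⟩, hga ⟨x, hx⟩⟩)
  have h2 : ∀ x : ℂ, ∃ G : ℂ → ℂ, x ∈ unitCircle → EqOn f G unitCircle ∧
      AnalyticOnNhd ℂ G (ball x δ) := by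
    intro x
    by_cases hx : x ∈ unitCircle
    · obtain ⟨i, hi⟩ := hc x hx
      exact ⟨g i, fun _ => ⟨hg i, hi⟩⟩
    · exact ⟨f, fun h => absurd h hx⟩
  choose G hG using h2
  -- near `w`, the extension around `z / ‖z‖` agrees with the one around `w`: both are analytic on
  -- the intersection of two disks, which contains points of the circle accumulating at `z / ‖z‖`
  have key : ∀ w ∈ unitCircle, (fun z => G (z / ‖z‖) z) =ᶠ[𝓝 w] G w := by
    intro w hw
    have hw0 := ne_zero_of_mem_unitCircle hw
    have hwn : w / (‖w‖ : ℂ) = w := by rw [mem_unitCircle.1 hw]; simp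
    have hcont : ContinuousAt (fun z : ℂ => z / (‖z‖ : ℂ)) w :=
      continuousAt_id.div (by fun_prop) (by simpa using hw0)
    have e1 : ∀ᶠ z in 𝓝 w, z / (‖z‖ : ℂ) ∈ ball w (δ / 2) :=
      hcont (by simp only [hwn]; exact ball_mem_nhds _ (by positivity))
    filter_upwards [e1, ball_mem_nhds w (half_pos hδ), isOpen_ne.mem_nhds hw0] with z hz1 hz2 hz0
    set x := z / (‖z‖ : ℂ) with hx
    have hxc : x ∈ unitCircle := by
      rw [mem_unitCircle, hx, norm_div]; simp [hz0]
    have hzx : z ∈ ball x δ := by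
      rw [mem_ball] at *
      calc dist z x ≤ dist z w + dist x w := dist_triangle_right _ _ _
        _ < δ := by linarith
    have hconv : IsPreconnected (ball x δ ∩ ball w δ) :=
      ((convex_ball x δ).inter (convex_ball w δ)).isPreconnected
    refine eqOn_unitCircle_of_frequently hconv ((hG x hxc).2.mono inter_subset_left)
      ((hG w hw).2.mono inter_subset_right) hxc ⟨mem_ball_self hδ, ?_⟩
      (fun y hy => ((hG x hxc).1 hy).symm.trans ((hG w hw).1 hy))
      ⟨hzx, ball_subset_ball (by linarith) hz2⟩
    exact ball_subset_ball (by linarith) hz1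
  refine ⟨fun z => G (z / ‖z‖) z, fun w hw => ?_, fun w hw => ?_⟩
  · exact ((hG w hw).2 w (mem_ball_self hδ)).congr (key w hw).symm
  · exact (key w hw).eq_of_nhds.trans ((hG w hw).1 hw).symm

/-- Reflection of a function in the unit circle: it is holomorphic near the circle when `f` is, and
on the circle its values are the complex conjugates of those of `f`. -/
noncomputable def circleReflect (f : ℂ → ℂ) (z : ℂ) : ℂ := conj (f (conj z)⁻¹)

lemma circleReflect_apply {f : ℂ → ℂ} {z : ℂ} (hz : z ∈ unitCircle) :
    circleReflect f z = conj (f z) := by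
  rw [circleReflect, conj_inv_of_mem_unitCircle hz]

lemma analyticAt_circleReflect {f : ℂ → ℂ} {z : ℂ} (hz : z ≠ 0)
    (hf : AnalyticAt ℂ f (conj z)⁻¹) : AnalyticAt ℂ (circleReflect f) z := by
  rw [analyticAt_iff_eventually_differentiableAt] at hf ⊢
  have hcont : ContinuousAt (fun z : ℂ => (conj z)⁻¹) z :=
    (continuous_conj.continuousAt).inv₀ (by simpa using hz)
  filter_upwards [hcont.eventually hf, isOpen_ne.mem_nhds hz] with y hy hy0
  have h1 : DifferentiableAt ℂ (fun z : ℂ => f z⁻¹) (conj y) :=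
    DifferentiableAt.comp (conj y) hy (differentiableAt_inv (by simpa using hy0))
  have h2 := h1.conj_conj
  rw [Complex.conj_conj] at h2
  exact h2

lemma analyticOnNhd_circleReflect {f : ℂ → ℂ} (hf : AnalyticOnNhd ℂ f unitCircle) :
    AnalyticOnNhd ℂ (circleReflect f) unitCircle := fun z hz =>
  analyticAt_circleReflect (ne_zero_of_mem_unitCircle hz)
    (by rw [conj_inv_of_mem_unitCircle hz]; exact hf z hz)

lemma finite_zeros {f : ℂ → ℂ} (hf : AnalyticOnNhd ℂ f unitCircle)
    (h : ∃ z ∈ unitCircle, f z ≠ 0) : {z ∈ unitCircle | f z = 0}.Finite := by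
  by_contra hinf
  obtain ⟨x, hx, hacc⟩ := Set.Infinite.exists_accPt_of_subset_isCompact hinf
    (isCompact_sphere (0 : ℂ) 1) (fun z hz => hz.1)
  rw [accPt_iff_frequently_nhdsNE] at hacc
  obtain ⟨z, hz, hne⟩ := h
  exact hne (hf.eqOn_zero_of_preconnected_of_frequently_eq_zero isPreconnected_unitCircle hx
    (hacc.mono fun y hy => hy.2) hz)

/-! ### Zeros on the circle and bounded quotients -/

lemma sub_mul_dslope {f : ℂ → ℂ} {a : ℂ} (ha : f a = 0) (z : ℂ) :
    f z = (z - a) * dslope f a z := by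
  have := sub_smul_dslope f a z
  rw [smul_eq_mul, ha, sub_zero] at this
  exact this.symm

lemma analyticOnNhd_dslope {f : ℂ → ℂ} {S : Set ℂ} (hf : AnalyticOnNhd ℂ f S) {a : ℂ}
    (ha : a ∈ S) : AnalyticOnNhd ℂ (dslope f a) S := by
  have hopen := isOpen_analyticAt ℂ f
  have h1 : DifferentiableOn ℂ f {x | AnalyticAt ℂ f x} := fun x hx =>
    (AnalyticAt.differentiableAt hx).differentiableWithinAt
  have h2 := (Complex.differentiableOn_dslope (hopen.mem_nhds (hf a ha))).2 h1
  exact fun z hz => (h2.analyticOnNhd hopen) z (hf z hz)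

/-- `f` is on `S` a polynomial of degree `m` times a nowhere vanishing analytic function. -/
def HasZeroDegree (S : Set ℂ) (f : ℂ → ℂ) (m : ℕ) : Prop :=
  ∃ P : Polynomial ℂ, P ≠ 0 ∧ P.natDegree = m ∧ ∃ u : ℂ → ℂ, AnalyticOnNhd ℂ u S ∧
    (∀ z ∈ S, u z ≠ 0) ∧ ∀ z ∈ S, f z = P.eval z * u z

/-- Each zero of `f` on the circle contributes a power of a linear factor to the polynomial; the
induction is on the number of zeros. -/
lemma exists_hasZeroDegree {S : Set ℂ} (hS : unitCircle ⊆ S) {f : ℂ → ℂ}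
    (hf : AnalyticOnNhd ℂ f S) (hne : ∀ z ∈ S, z ∉ unitCircle → f z ≠ 0)
    (h : ∃ z ∈ unitCircle, f z ≠ 0) : ∃ m, HasZeroDegree S f m := by
  induction hN : {z ∈ unitCircle | f z = 0}.ncard using Nat.strong_induction_on generalizing f with
  | _ N ih =>
  by_cases hz : ∃ a ∈ unitCircle, f a = 0
  swap
  · refine ⟨0, 1, one_ne_zero, by simp, f, hf, fun z hzS hfz => ?_, fun z _ => by simp⟩
    by_cases hzc : z ∈ unitCircle
    · exact hz ⟨z, hzc, hfz⟩
    · exact hne z hzS hzc hfz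
  obtain ⟨a, ha, hfa⟩ := hz
  have hfin := finite_zeros (hf.mono hS) h
  have hnz : ¬ ∀ᶠ z in 𝓝 a, f z = 0 := by
    intro hev
    obtain ⟨z, hz, hz0⟩ := h
    exact hz0 ((hf.mono hS).eqOn_zero_of_preconnected_of_eventuallyEq_zero
      isPreconnected_unitCircle ha hev hz)
  obtain ⟨n, g, hg, hga, hfg⟩ := (hf a (hS ha)).exists_eventuallyEq_pow_smul_nonzero_iff.2 hnz
  let f₁ : ℂ → ℂ := fun z => if z = a then g a else f z / (z - a) ^ n
  have hf₁g : f₁ =ᶠ[𝓝 a] g := by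
    filter_upwards [hfg] with z hz
    by_cases hza : z = a
    · simp [f₁, hza]
    · have : (z - a) ^ n ≠ 0 := pow_ne_zero _ (sub_ne_zero.2 hza)
      simp only [f₁, hza, if_false, hz, smul_eq_mul]
      field_simp
  have hff₁ : ∀ z, f z = (z - a) ^ n * f₁ z := by
    intro z
    by_cases hza : z = a
    · have := hfg.self_of_nhds
      simpa [f₁, hza] using this
    · have : (z - a) ^ n ≠ 0 := pow_ne_zero _ (sub_ne_zero.2 hza)
      simp only [f₁, hza, if_false]
      field_simp
  have hf₁ : AnalyticOnNhd ℂ f₁ S := by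
    intro z hz
    by_cases hza : z = a
    · subst hza
      exact hg.congr hf₁g.symm
    · have h1 : AnalyticAt ℂ (fun z => f z / (z - a) ^ n) z :=
        (hf z hz).div (by fun_prop) (pow_ne_zero _ (sub_ne_zero.2 hza))
      refine h1.congr ?_
      filter_upwards [isOpen_ne.mem_nhds hza] with y hy
      simp [f₁, show y ≠ a from hy]
  have hf₁a : f₁ a ≠ 0 := by simpa [f₁] using hga
  have hlt : {z ∈ unitCircle | f₁ z = 0}.ncard < N := by
    rw [← hN]
    refine Set.ncard_lt_ncard ?_ hfin
    refine ⟨fun z hz => ⟨hz.1, by rw [hff₁, hz.2, mul_zero]⟩, fun hsub => ?_⟩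
    exact hf₁a (hsub ⟨ha, hfa⟩).2
  obtain ⟨m, P, hP, hPm, u, hu, hu0, hfu⟩ := ih _ hlt hf₁
    (fun z hz hzc h0 => hne z hz hzc (by rw [hff₁, h0, mul_zero])) ⟨a, ha, hf₁a⟩ rfl
  refine ⟨_, (Polynomial.X - Polynomial.C a) ^ n * P,
    mul_ne_zero (pow_ne_zero _ (Polynomial.X_sub_C_ne_zero a)) hP, rfl, u, hu, hu0, fun z hz => ?_⟩
  rw [hff₁, hfu z hz]
  simp [mul_assoc]

lemma HasZeroDegree.of_eq_sub_mul {S : Set ℂ} (hS : unitCircle ⊆ S) {f f₁ : ℂ → ℂ} {m : ℕ} {a : ℂ}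
    (h : HasZeroDegree S f m) (ha : a ∈ unitCircle) (hf₁ : AnalyticOnNhd ℂ f₁ S)
    (hff₁ : ∀ z ∈ S, f z = (z - a) * f₁ z) : ∃ m₁, m = m₁ + 1 ∧ HasZeroDegree S f₁ m₁ := by
  obtain ⟨P, hP, hPm, u, hu, hu0, hfu⟩ := h
  have hroot : P.IsRoot a := by
    have h1 := hfu a (hS ha)
    rw [hff₁ a (hS ha), sub_self, zero_mul] at h1
    exact (mul_eq_zero.1 h1.symm).resolve_right (hu0 a (hS ha))
  obtain ⟨Q, rfl⟩ := Polynomial.dvd_iff_isRoot.2 hroot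
  have hQ : Q ≠ 0 := right_ne_zero_of_mul hP
  have hne : ∀ z ∈ S, z ≠ a → f₁ z = Q.eval z * u z := by
    intro z hz hza
    have h1 := hfu z hz
    rw [hff₁ z hz] at h1
    simp only [Polynomial.eval_mul, Polynomial.eval_sub, Polynomial.eval_X, Polynomial.eval_C,
      mul_assoc] at h1
    exact mul_left_cancel₀ (sub_ne_zero.2 hza) h1
  refine ⟨Q.natDegree, ?_, Q, hQ, rfl, u, hu, hu0, fun z hz => ?_⟩
  · rw [← hPm, Polynomial.natDegree_mul (Polynomial.X_sub_C_ne_zero a) hQ,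
      Polynomial.natDegree_X_sub_C, add_comm]
  by_cases hza : z = a
  swap
  · exact hne z hz hza
  subst hza
  refine eqOn_of_finite_exception (f := f₁) (g := fun z => Q.eval z * u z) (T := {z})
    (hf₁.mono hS).continuousOn ?_ (finite_singleton _) (fun y hy => hne y (hS hy.1) hy.2) ha
  exact (Q.continuous.continuousOn).mul (hu.mono hS).continuousOn

/-- A quotient of analytic functions that is bounded on the circle is analytic there: a zero of the
denominator on the circle is a zero of the numerator, and the common factor `z - a` cancels. -/
lemma exists_quotient_of_bounded {S : Set ℂ} (hS : unitCircle ⊆ S) {f d : ℂ → ℂ}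
    (hf : AnalyticOnNhd ℂ f S) (hd : AnalyticOnNhd ℂ d S)
    (hne : ∀ z ∈ S, z ∉ unitCircle → d z ≠ 0) (h : ∃ z ∈ unitCircle, d z ≠ 0) {B : ℝ}
    (hB : ∀ z ∈ unitCircle, ‖f z‖ ≤ B * ‖d z‖) :
    ∃ q : ℂ → ℂ, AnalyticOnNhd ℂ q S ∧ ∀ z ∈ S, f z = q z * d z := by
  obtain ⟨m, hm⟩ := exists_hasZeroDegree hS hd hne h
  induction m using Nat.strong_induction_on generalizing f d with
  | _ m ih =>
  by_cases hz : ∃ a ∈ unitCircle, d a = 0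
  swap
  · have hd0 : ∀ z ∈ S, d z ≠ 0 := fun z hzS hdz => by
      by_cases hzc : z ∈ unitCircle
      · exact hz ⟨z, hzc, hdz⟩
      · exact hne z hzS hzc hdz
    exact ⟨fun z => f z / d z, hf.div hd hd0, fun z hz => (div_mul_cancel₀ _ (hd0 z hz)).symm⟩
  obtain ⟨a, ha, hda⟩ := hz
  have hfa : f a = 0 := by
    have := hB a ha
    rw [hda, norm_zero, mul_zero] at this
    exact norm_le_zero_iff.1 this
  have hf' := analyticOnNhd_dslope hf (hS ha)
  have hd' := analyticOnNhd_dslope hd (hS ha)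
  have ef := sub_mul_dslope hfa
  have ed := sub_mul_dslope hda
  obtain ⟨m₁, hm₁, hdeg⟩ := hm.of_eq_sub_mul hS ha hd' (fun z _ => ed z)
  obtain ⟨q, hq, hqe⟩ := ih m₁ (by omega) hf' hd'
    (fun z hzS hzc h0 => hne z hzS hzc (by rw [ed, h0, mul_zero]))
    (by obtain ⟨z, hz, hz0⟩ := h; exact ⟨z, hz, fun h0 => hz0 (by rw [ed, h0, mul_zero])⟩)
    (fun z hz => by
      refine mem_of_finite_exception
        (F := fun z => B * ‖dslope d a z‖ - ‖dslope f a z‖) (K := Ici 0) (T := {a}) ?_ isClosed_Ici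
        (finite_singleton _) (fun y hy => ?_) hz |> fun h => sub_nonneg.1 h
      · exact (continuousOn_const.mul (hd'.mono hS).continuousOn.norm).sub
          (hf'.mono hS).continuousOn.norm
      · have h1 := hB y hy.1
        have h2 : 0 < ‖y - a‖ := norm_pos_iff.2 (sub_ne_zero.2 hy.2)
        rw [ef, ed, norm_mul, norm_mul] at h1
        rw [mem_Ici, sub_nonneg]
        refine le_of_mul_le_mul_left ?_ h2
        linarith) hdeg
  exact ⟨q, hq, fun z hz => by rw [ef, ed, hqe z hz]; ring⟩

/-! ### Cauchy integrals and the splitting of functions on the circle -/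

/-- The closed unit disk. -/
abbrev closedDisk : Set ℂ := closedBall 0 1

lemma unitCircle_subset_closedDisk : unitCircle ⊆ closedDisk := sphere_subset_closedBall

lemma exists_annulus {E : ℂ → ℂ} (hE : AnalyticOnNhd ℂ E unitCircle) :
    ∃ r R : ℝ, 0 < r ∧ r < 1 ∧ 1 < R ∧ ∀ z : ℂ, r ≤ ‖z‖ → ‖z‖ ≤ R → AnalyticAt ℂ E z := by
  obtain ⟨δ, hδ, hsub⟩ := (isCompact_sphere (0 : ℂ) 1).exists_thickening_subset_open
    (isOpen_analyticAt ℂ E) hE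
  refine ⟨max (1 / 2) (1 - δ / 2), 1 + δ / 2, by positivity, ?_, by linarith, fun z h1 h2 => ?_⟩
  · exact max_lt (by norm_num) (by linarith)
  have h3 : 1 / 2 ≤ ‖z‖ := (le_max_left _ _).trans h1
  have h4 : 1 - δ / 2 ≤ ‖z‖ := (le_max_right _ _).trans h1
  have hz : z ≠ 0 := by rintro rfl; norm_num at h3
  refine hsub (mem_thickening_iff.2 ⟨z / (‖z‖ : ℂ), by simp [hz], ?_⟩)
  have hn : (‖z‖ : ℂ) ≠ 0 := by simpa using hz
  have h5 : z - z / (‖z‖ : ℂ) = (z / (‖z‖ : ℂ)) * ((‖z‖ - 1 : ℝ) : ℂ) := by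
    push_cast; field_simp
  rw [dist_eq_norm, h5, norm_mul, norm_div, norm_real, norm_real, norm_norm,
    div_self (norm_ne_zero_iff.2 hz), one_mul, Real.norm_eq_abs, abs_lt]
  constructor <;> linarith

/-- The Cauchy integral of `f` over the circle of radius `R` around the origin. -/
noncomputable def cauchyIntegral (f : ℂ → ℂ) (R : ℝ) (z : ℂ) : ℂ :=
  (2 * Real.pi * I : ℂ)⁻¹ * ∮ w in C(0, R), (w - z)⁻¹ * f w

lemma analyticOnNhd_cauchyIntegral {f : ℂ → ℂ} {R : ℝ} (hR : 1 < R)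
    (hf : ∀ z : ℂ, ‖z‖ = R → AnalyticAt ℂ f z) :
    AnalyticOnNhd ℂ (cauchyIntegral f R) closedDisk := by
  have hR0 : 0 < R := by linarith
  lift R to NNReal using hR0.le
  have h1 : CircleIntegrable f 0 R :=
    ContinuousOn.circleIntegrable hR0.le fun z hz =>
      (hf z (by simpa using hz)).continuousAt.continuousWithinAt
  have h2 := hasFPowerSeriesOn_cauchy_integral h1 (by exact_mod_cast hR0)
  refine fun z hz => h2.analyticOnNhd z ?_
  rw [Metric.eball_coe]
  exact closedBall_subset_ball hR hz

/-- A function that is continuous on the closed disk, holomorphic inside, and analytic along the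
circle is holomorphic near the closed disk: its Cauchy integral over the unit circle may be taken
over a larger circle. -/
lemma exists_analyticOnNhd_closedDisk {F E : ℂ → ℂ} (hF : DiffContOnCl ℂ F unitDisk)
    (hE : AnalyticOnNhd ℂ E unitCircle) (h : EqOn F E unitCircle) :
    ∃ G : ℂ → ℂ, AnalyticOnNhd ℂ G closedDisk ∧ EqOn G F closedDisk := by
  obtain ⟨r, R, hr, hr1, hR, hER⟩ := exists_annulus hE
  have hG : AnalyticOnNhd ℂ (cauchyIntegral E R) closedDisk :=
    analyticOnNhd_cauchyIntegral hR fun z hz => hER z (by linarith) hz.le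
  have hin : EqOn (cauchyIntegral E R) F unitDisk := by
    intro z hz
    have hz1 : ‖z‖ < 1 := by simpa using hz
    have hne : ∀ w : ℂ, 1 ≤ ‖w‖ → w - z ≠ 0 := fun w hw h0 => by
      rw [sub_eq_zero.1 h0] at hw; linarith
    have hd : ∀ w : ℂ, 1 ≤ ‖w‖ → ‖w‖ ≤ R → DifferentiableAt ℂ (fun w => (w - z)⁻¹ * E w) w :=
      fun w hw hwR => ((differentiableAt_id.sub_const z).inv (hne w hw)).mul
        (hER w (by linarith) hwR).differentiableAt
    have h1 : (∮ w in C(0, R), (w - z)⁻¹ * E w) = ∮ w in C(0, 1), (w - z)⁻¹ * E w := by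
      refine circleIntegral_eq_of_differentiable_on_annulus_off_countable one_pos hR.le
        countable_empty ?_ ?_
      · rintro w ⟨hw1, hw2⟩
        exact (hd w (by simpa using hw2) (by simpa using hw1)).continuousAt.continuousWithinAt
      · rintro w ⟨⟨hw1, hw2⟩, -⟩
        rw [mem_ball_zero_iff] at hw1
        rw [mem_closedBall_zero_iff, not_le] at hw2
        exact hd w hw2.le hw1.le
    have h2 : (∮ w in C(0, 1), (w - z)⁻¹ * E w) = ∮ w in C(0, 1), (w - z)⁻¹ • F w := by
      refine circleIntegral.integral_congr zero_le_one fun w hw => ?_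
      simp only [smul_eq_mul, h hw]
    rw [cauchyIntegral, h1, h2, hF.circleIntegral_sub_inv_smul hz, smul_eq_mul,
      inv_mul_cancel_left₀ two_pi_I_ne_zero]
  refine ⟨_, hG, ?_⟩
  have hcl : closure unitDisk = closedDisk := closure_ball 0 one_ne_zero
  exact hin.of_subset_closure hG.continuousOn (hcl ▸ hF.2) ball_subset_closedBall hcl.ge

/-- Cauchy's formula for an annulus around the unit circle. -/
lemma cauchyIntegral_sub_cauchyIntegral {E : ℂ → ℂ} {r R : ℝ} (hr : 0 < r) (hr1 : r < 1)
    (hR : 1 < R) (hE : ∀ z : ℂ, r ≤ ‖z‖ → ‖z‖ ≤ R → AnalyticAt ℂ E z) {z : ℂ}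
    (hz : z ∈ unitCircle) : cauchyIntegral E R z - cauchyIntegral E r z = E z := by
  rw [mem_unitCircle] at hz
  have hEa : AnalyticOnNhd ℂ E {w | r ≤ ‖w‖ ∧ ‖w‖ ≤ R} := fun w hw => hE w hw.1 hw.2
  have hds : AnalyticOnNhd ℂ (dslope E z) {w | r ≤ ‖w‖ ∧ ‖w‖ ≤ R} :=
    analyticOnNhd_dslope hEa ⟨by linarith, by linarith⟩
  -- the difference quotient of `E` at `z` is holomorphic in the annulus, including the point `z`
  have hann : (∮ w in C(0, R), dslope E z w) = ∮ w in C(0, r), dslope E z w := by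
    refine circleIntegral_eq_of_differentiable_on_annulus_off_countable hr (by linarith)
      countable_empty ?_ ?_
    · refine hds.continuousOn.mono fun w hw => ?_
      simpa [and_comm] using hw
    · rintro w ⟨⟨hw1, hw2⟩, -⟩
      rw [mem_ball_zero_iff] at hw1
      rw [mem_closedBall_zero_iff, not_le] at hw2
      exact (hds w ⟨hw2.le, hw1.le⟩).differentiableAt
  have hsplit : ∀ s : ℝ, r ≤ s → s ≤ R → s ≠ 1 → (∮ w in C(0, s), dslope E z w) =
      (∮ w in C(0, s), (w - z)⁻¹ * E w) - (∮ w in C(0, s), (w - z)⁻¹) * E z := by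
    intro s hs1 hs2 hs
    have hs0 : 0 ≤ s := by linarith
    have hne : ∀ w : ℂ, ‖w‖ = s → w ≠ z := by rintro w hw rfl; exact hs (hw.symm.trans hz)
    have hci : ContinuousOn (fun w : ℂ => (w - z)⁻¹) (sphere 0 s) := fun w hw =>
      ((continuousAt_id.sub continuousAt_const).inv₀
        (sub_ne_zero.2 (hne w (by simpa using hw)))).continuousWithinAt
    have hcE : ContinuousOn E (sphere 0 s) := fun w hw => by
      have : ‖w‖ = s := by simpa using hw
      exact (hE w (by linarith) (by linarith)).continuousAt.continuousWithinAt
    have e1 : (∮ w in C(0, s), (w - z)⁻¹) * E z = ∮ w in C(0, s), (w - z)⁻¹ * E z := by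
      simp [mul_comm]
    have i1 : CircleIntegrable (fun w => (w - z)⁻¹ * E w) 0 s := (hci.mul hcE).circleIntegrable hs0
    have i2 : CircleIntegrable (fun w => (w - z)⁻¹ * E z) 0 s :=
      (hci.mul continuousOn_const).circleIntegrable hs0
    rw [e1, ← circleIntegral.integral_sub i1 i2]
    refine circleIntegral.integral_congr hs0 fun w hw => ?_
    simp only [dslope_of_ne E (hne w (by simpa using hw)), slope_def_module, smul_eq_mul]
    ring
  rw [hsplit R (by linarith) le_rfl hR.ne', hsplit r le_rfl (by linarith) hr1.ne,
    circleIntegral.integral_sub_inv_of_mem_ball (by simpa [hz] using hR)] at hann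
  have h0 : (∮ w in C(0, r), (w - z)⁻¹) = 0 := by
    have hd : ∀ w ∈ closedBall (0 : ℂ) r, DifferentiableAt ℂ (fun w : ℂ => (w - z)⁻¹) w := by
      intro w hw
      refine (differentiableAt_id.sub_const z).inv (sub_ne_zero.2 ?_)
      rintro rfl
      simp only [id, mem_closedBall_zero_iff] at hw hz
      linarith
    exact circleIntegral_eq_zero_of_differentiable_on_off_countable hr.le countable_empty
      (fun w hw => (hd w hw).continuousAt.continuousWithinAt)
      (fun w hw => hd w (ball_subset_closedBall hw.1))
  rw [h0, zero_mul, sub_zero] at hann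
  rw [cauchyIntegral, cauchyIntegral, ← hann, ← mul_sub, sub_sub_cancel,
    inv_mul_cancel_left₀ two_pi_I_ne_zero]

/-- The inner Cauchy integral is the conjugate of an outer Cauchy integral of the reflection. -/
lemma neg_cauchyIntegral_eq_conj {E : ℂ → ℂ} {r : ℝ} (hr : 0 < r) (hr1 : r < 1)
    (hE : ∀ z : ℂ, ‖z‖ = r → AnalyticAt ℂ E z) {z : ℂ} (hz : z ∈ unitCircle) :
    -cauchyIntegral E r z =
      conj (cauchyIntegral (circleReflect E) r⁻¹ z - cauchyIntegral (circleReflect E) r⁻¹ 0) := by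
  have hz0 := ne_zero_of_mem_unitCircle hz
  have hzc := conj_inv_of_mem_unitCircle hz
  have hz1 := mem_unitCircle.1 hz
  have hrinv : 1 < r⁻¹ := (one_lt_inv₀ hr).2 hr1
  have hcR : ContinuousOn (circleReflect E) (sphere 0 r⁻¹) := fun w hw => by
    have hw' : ‖w‖ = r⁻¹ := by simpa using hw
    have hw0 : w ≠ 0 := by rintro rfl; rw [norm_zero] at hw'; linarith
    exact (analyticAt_circleReflect hw0 (hE _ (by simp [hw']))).continuousAt.continuousWithinAt
  have hci : ∀ a : ℂ, ‖a‖ ≤ 1 → ContinuousOn (fun w : ℂ => (w - a)⁻¹) (sphere 0 r⁻¹) :=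
    fun a ha w hw => ((continuousAt_id.sub continuousAt_const).inv₀ (sub_ne_zero.2 (by
      rintro rfl
      have hw' : ‖w‖ = r⁻¹ := by simpa using hw
      simp only [id] at ha
      linarith))).continuousWithinAt
  have i1 : ∀ a : ℂ, ‖a‖ ≤ 1 → CircleIntegrable (fun w => (w - a)⁻¹ * circleReflect E w) 0 r⁻¹ :=
    fun a ha => ((hci a ha).mul hcR).circleIntegrable (by positivity)
  rw [cauchyIntegral, cauchyIntegral, cauchyIntegral, ← mul_sub,
    ← circleIntegral.integral_sub (i1 z hz1.le) (i1 0 (by simp))]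
  -- substitute `w ↦ 1 / conj w`, which maps the circle of radius `r` to the one of radius `r⁻¹` and
  -- preserves the angle; the kernel `1 / (w - z)` turns into `1 / (w - z) - 1 / w`
  simp only [circleIntegral, map_mul, smul_eq_mul, deriv_circleMap]
  rw [intervalIntegral.integral_of_le Real.two_pi_pos.le,
    intervalIntegral.integral_of_le Real.two_pi_pos.le, ← integral_conj, map_inv₀, map_mul,
    conj_I, mul_neg, inv_neg, neg_mul]
  simp only [map_mul, conj_ofReal, map_ofNat]
  congr 2
  refine MeasureTheory.integral_congr_ae (Eventually.of_forall fun θ => ?_)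
  have hw : conj (circleMap 0 r⁻¹ θ) = (circleMap 0 r θ)⁻¹ := by
    simp [circleMap, ← exp_conj, ← Complex.exp_neg, mul_comm]
  have hw0 : circleMap 0 r θ ≠ 0 := circleMap_ne_center hr.ne'
  have hwz : circleMap 0 r θ - z ≠ 0 := by
    intro h0
    have := norm_circleMap_zero r θ
    rw [sub_eq_zero.1 h0, hz1, abs_of_pos hr] at this
    linarith
  have hzw : z - circleMap 0 r θ ≠ 0 := by rw [← neg_sub]; exact neg_ne_zero.2 hwz
  have hcz : conj z = z⁻¹ := by rw [← hzc, inv_inv, hzc]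
  simp only [circleReflect, hw, map_sub, map_mul, map_inv₀, conj_I, hcz, Complex.conj_conj,
    inv_inv, sub_zero]
  have : (circleMap 0 r θ)⁻¹ - z⁻¹ ≠ 0 := by
    rw [inv_sub_inv hw0 hz0]; exact div_ne_zero hzw (mul_ne_zero hw0 hz0)
  rw [inv_sub_inv hw0 hz0]
  field_simp
  ring

/-- The splitting of an analytic function on the circle into its parts with nonnegative and with
negative frequencies. -/
lemma exists_splitting {E : ℂ → ℂ} (hE : AnalyticOnNhd ℂ E unitCircle) :
    ∃ u w : ℂ → ℂ, AnalyticOnNhd ℂ u closedDisk ∧ AnalyticOnNhd ℂ w closedDisk ∧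
      ∀ z ∈ unitCircle, E z = u z + conj (w z) := by
  obtain ⟨r, R, hr, hr1, hR, hER⟩ := exists_annulus hE
  refine ⟨cauchyIntegral E R, fun z =>
    cauchyIntegral (circleReflect E) r⁻¹ z - cauchyIntegral (circleReflect E) r⁻¹ 0,
    analyticOnNhd_cauchyIntegral hR fun z hz => hER z (by linarith) hz.le, ?_, fun z hz => ?_⟩
  · have hrinv : 1 < r⁻¹ := (one_lt_inv₀ hr).2 hr1
    refine (analyticOnNhd_cauchyIntegral hrinv fun z hz => ?_).sub analyticOnNhd_const
    have hz0 : z ≠ 0 := by rintro rfl; rw [norm_zero] at hz; linarith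
    exact analyticAt_circleReflect hz0 (hER _ (by simp [hz]) (by simp [hz]; linarith))
  · rw [← neg_cauchyIntegral_eq_conj hr hr1 (fun w hw => hER w hw.ge (by linarith)) hz,
      ← sub_eq_add_neg, cauchyIntegral_sub_cauchyIntegral hr hr1 hR hER hz]

/-! ### Power series on the closed disk -/

lemma exists_radius {f : ℂ → ℂ} (hf : AnalyticOnNhd ℂ f closedDisk) :
    ∃ R : ℝ, 1 < R ∧ DifferentiableOn ℂ f (closedBall 0 R) := by
  obtain ⟨δ, hδ, hsub⟩ := (isCompact_closedBall (0 : ℂ) 1).exists_thickening_subset_open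
    (isOpen_analyticAt ℂ f) hf
  rw [thickening_closedBall hδ zero_le_one] at hsub
  exact ⟨1 + δ / 2, by linarith, fun z hz => (AnalyticAt.differentiableAt (hsub
    (closedBall_subset_ball (by linarith) hz))).differentiableWithinAt⟩

lemma exists_coeff {f : ℂ → ℂ} (hf : AnalyticOnNhd ℂ f closedDisk) :
    ∃ (c : ℕ → ℂ) (C ρ : ℝ), 0 < ρ ∧ ρ < 1 ∧ (∀ n, ‖c n‖ ≤ C * ρ ^ n) ∧
      ∀ z ∈ closedDisk, HasSum (fun n => c n * z ^ n) (f z) := by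
  obtain ⟨R, hR, hd⟩ := exists_radius hf
  have hR0 : 0 < R := by linarith
  lift R to NNReal using hR0.le
  have hp := hd.hasFPowerSeriesOnBall (by exact_mod_cast hR0)
  have hs : ∀ z : ℂ, ‖z‖ < R →
      HasSum (fun n => (cauchyPowerSeries f 0 R).coeff n * z ^ n) (f z) := by
    intro z hz
    have := hp.hasSum (y := z) (by rw [Metric.eball_coe]; simpa using hz)
    simpa [FormalMultilinearSeries.apply_eq_pow_smul_coeff, mul_comm] using this
  set σ : ℝ := (1 + R) / 2 with hσ
  have hσ1 : 1 < σ := by rw [hσ]; linarith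
  have hsσ := hs (σ : ℂ) (by rw [norm_real, Real.norm_of_nonneg (by linarith)]; linarith)
  obtain ⟨C, hC⟩ := hsσ.summable.tendsto_atTop_zero.norm.bddAbove_range
  refine ⟨_, C, σ⁻¹, by positivity, inv_lt_one_of_one_lt₀ hσ1, fun n => ?_, fun z hz => hs z ?_⟩
  · have h1 := hC ⟨n, rfl⟩
    simp only [norm_mul, norm_pow, norm_real, Real.norm_of_nonneg (by linarith : 0 ≤ σ)] at h1
    rw [inv_pow, ← div_eq_mul_inv, le_div_iff₀ (by positivity)]
    exact h1
  · have : ‖z‖ ≤ 1 := by simpa using hz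
    linarith

lemma norm_mul_pow_le {c : ℕ → ℂ} {C ρ : ℝ} (hc : ∀ n, ‖c n‖ ≤ C * ρ ^ n) {z : ℂ}
    (hz : z ∈ closedDisk) (n : ℕ) : ‖c n * z ^ n‖ ≤ C * ρ ^ n := by
  have hz' : ‖z‖ ≤ 1 := by simpa using hz
  rw [norm_mul, norm_pow]
  exact (mul_le_of_le_one_right (norm_nonneg _) (pow_le_one₀ (norm_nonneg _) hz')).trans (hc n)

lemma summable_coeff {c : ℕ → ℂ} {C ρ : ℝ} (h0 : 0 < ρ) (h1 : ρ < 1)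
    (hc : ∀ n, ‖c n‖ ≤ C * ρ ^ n) {z : ℂ} (hz : z ∈ closedDisk) :
    Summable fun n => c n * z ^ n :=
  .of_norm_bounded ((summable_geometric_of_lt_one h0.le h1).mul_left C)
    fun n => norm_mul_pow_le hc hz n

lemma analyticOnNhd_tsum_coeff {c : ℕ → ℂ} {C ρ : ℝ} (h0 : 0 < ρ) (h1 : ρ < 1)
    (hc : ∀ n, ‖c n‖ ≤ C * ρ ^ n) : AnalyticOnNhd ℂ (fun z => ∑' n, c n * z ^ n) closedDisk := by
  obtain ⟨σ, hσ1, hσ2⟩ := exists_between h1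
  have hσ0 : 0 < σ := h0.trans hσ1
  have hd : DifferentiableOn ℂ (fun z => ∑' n, c n * z ^ n) (ball 0 σ⁻¹) := by
    refine differentiableOn_tsum_of_summable_norm (u := fun n => C * (ρ / σ) ^ n)
      ((summable_geometric_of_lt_one (by positivity) ((div_lt_one hσ0).2 hσ1)).mul_left C)
      (fun n => by fun_prop) isOpen_ball fun n z hz => ?_
    have hz' : ‖z‖ ≤ σ⁻¹ := by
      have := mem_ball_zero_iff.1 hz
      linarith
    rw [norm_mul, norm_pow, div_pow, div_eq_mul_inv, ← inv_pow, ← mul_assoc]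
    exact mul_le_mul (hc n) (pow_le_pow_left₀ (norm_nonneg _) hz' n) (by positivity)
      ((norm_nonneg _).trans (hc n))
  exact (hd.analyticOnNhd isOpen_ball).mono
    (closedBall_subset_ball ((one_lt_inv₀ hσ0).2 hσ2))

/-! ### Functions on the closed disk with real boundary values -/

/-- The maximum principle for the exponentials of `± i f`. -/
lemma im_eq_zero_of_im_eq_zero_on_circle {f : ℂ → ℂ} (hf : AnalyticOnNhd ℂ f closedDisk)
    (h : ∀ z ∈ unitCircle, (f z).im = 0) {z : ℂ} (hz : z ∈ closedDisk) : (f z).im = 0 := by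
  have key : ∀ g : ℂ → ℂ, AnalyticOnNhd ℂ g closedDisk → (∀ z ∈ unitCircle, (g z).im = 0) →
      0 ≤ (g z).im := by
    intro g hg hgi
    have hcl : closure unitDisk = closedDisk := closure_ball 0 one_ne_zero
    have hd : DiffContOnCl ℂ (fun z => exp (I * g z)) unitDisk := by
      refine ⟨fun w hw => ?_, ?_⟩
      · have := (hg w (ball_subset_closedBall hw)).differentiableAt
        exact (this.const_mul I).cexp.differentiableWithinAt
      · rw [hcl]
        exact (continuousOn_const.mul hg.continuousOn).cexp
    have h1 := norm_le_of_forall_mem_frontier_norm_le (C := 1) isBounded_ball hd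
      (fun w hw => by
        rw [frontier_ball 0 one_ne_zero] at hw
        simp [norm_exp, hgi w hw]) (hcl ▸ hz)
    rw [norm_exp, Real.exp_le_one_iff] at h1
    simpa using h1
  refine le_antisymm ?_ (key f hf h)
  simpa using key (fun z => -f z) hf.neg (by simpa using h)

/-- The imaginary part vanishes in the disk as well, so that the open mapping theorem applies. -/
lemma exists_eq_const_of_real {f : ℂ → ℂ} (hf : AnalyticOnNhd ℂ f closedDisk)
    (h : ∀ z ∈ unitCircle, (f z).im = 0) : ∃ c : ℝ, ∀ z ∈ closedDisk, f z = c := by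
  have hcl : closure unitDisk = closedDisk := closure_ball 0 one_ne_zero
  have h1 : ∃ w, ∀ z ∈ unitDisk, f z = w := by
    refine ((hf.mono ball_subset_closedBall).is_constant_or_isOpen
      (convex_ball (0 : ℂ) 1).isPreconnected).resolve_right fun hopen => ?_
    have h2 := hopen unitDisk le_rfl isOpen_ball
    have h3 : f '' unitDisk ⊆ {z | z.im ≤ 0} := by
      rintro _ ⟨z, hz, rfl⟩
      exact (im_eq_zero_of_im_eq_zero_on_circle hf h (ball_subset_closedBall hz)).le
    have h4 := h2.subset_interior_iff.2 h3 ⟨0, by simp, rfl⟩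
    rw [interior_setOfPred_im_le] at h4
    have h5 : (f 0).im < 0 := h4
    rw [im_eq_zero_of_im_eq_zero_on_circle hf h (by simp)] at h5
    exact lt_irrefl _ h5
  obtain ⟨w, hw⟩ := h1
  have h2 : EqOn f (fun _ => w) closedDisk :=
    EqOn.of_subset_closure (s := unitDisk) hw hf.continuousOn continuousOn_const
      ball_subset_closedBall hcl.ge
  refine ⟨w.re, fun z hz => ?_⟩
  have h3 := im_eq_zero_of_im_eq_zero_on_circle hf h hz
  rw [h2 hz] at h3 ⊢
  exact Complex.ext rfl (by simpa using h3)

/-! ### A Hankel equation on square summable sequences -/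

/-- The Hilbert space of square summable sequences. -/
abbrev L2 : Type := lp (fun _ : ℕ => ℂ) 2

lemma summable_sq_geometric {C ρ : ℝ} (h0 : 0 < ρ) (h1 : ρ < 1) :
    Summable fun k : ℕ => (C * ρ ^ k) ^ 2 := by
  have h2 : ρ ^ 2 < 1 := pow_lt_one₀ h0.le h1 two_ne_zero
  refine ((summable_geometric_of_lt_one (by positivity) h2).mul_left (C ^ 2)).congr fun k => ?_
  rw [mul_pow, ← pow_mul, ← pow_mul, mul_comm k 2]

/-- The rows of the Hankel matrix of a geometrically decaying sequence, conjugated so that pairing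
with them is `inner`. -/
lemma exists_rows {w : ℕ → ℂ} {C ρ : ℝ} (h0 : 0 < ρ) (h1 : ρ < 1)
    (hw : ∀ n, ‖w n‖ ≤ C * ρ ^ n) :
    ∃ (h : ℕ → L2) (K : ℝ), (∀ n k, h n k = conj (w (n + k))) ∧ ∀ n, ‖h n‖ ≤ K * ρ ^ n := by
  have hb : ∀ n k, ‖conj (w (n + k))‖ ^ 2 ≤ ρ ^ (2 * n) * (C * ρ ^ k) ^ 2 := fun n k => by
    rw [RCLike.norm_conj]
    calc ‖w (n + k)‖ ^ 2 ≤ (C * ρ ^ (n + k)) ^ 2 := pow_le_pow_left₀ (norm_nonneg _) (hw _) 2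
      _ = _ := by ring
  have hs := summable_sq_geometric (C := C) h0 h1
  have hsn : ∀ n, Summable fun k => ‖conj (w (n + k))‖ ^ 2 := fun n =>
    Summable.of_nonneg_of_le (fun _ => by positivity) (hb n) (hs.mul_left _)
  have hm : ∀ n, Memℓp (E := fun _ : ℕ => ℂ) (fun k => conj (w (n + k))) 2 := fun n =>
    memℓp_gen (by simpa using hsn n)
  refine ⟨fun n => ⟨_, hm n⟩, Real.sqrt (∑' k : ℕ, (C * ρ ^ k) ^ 2), fun n k => rfl, fun n => ?_⟩
  have h2 : ‖(⟨_, hm n⟩ : L2)‖ ^ 2 = ∑' k, ‖conj (w (n + k))‖ ^ 2 := by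
    have := lp.norm_rpow_eq_tsum (p := 2) (by norm_num) (⟨_, hm n⟩ : L2)
    simpa using this
  refine le_of_sq_le_sq ?_ (by positivity)
  rw [h2, mul_pow, Real.sq_sqrt (tsum_nonneg fun k => by positivity), ← pow_mul, mul_comm n 2,
    mul_comm, ← tsum_mul_left]
  exact (hsn n).tsum_le_tsum (hb n) (hs.mul_left _)

/-- The operator with given rows of geometrically decaying norms, as a norm convergent series of
operators of rank one. -/
lemma exists_operator_of_rows {C ρ : ℝ} (h0 : 0 < ρ) (h1 : ρ < 1) {h : ℕ → L2}
    (hh : ∀ n, ‖h n‖ ≤ C * ρ ^ n) :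
    ∃ W : L2 →L[ℂ] L2, ∀ x n, W x n = inner ℂ (h n) x := by
  let e : ℕ → L2 := fun n => lp.single 2 n 1
  have he : ∀ n, ‖e n‖ = 1 := fun n => by
    simp [e]
  have hsum : Summable fun n => InnerProductSpace.rankOne ℂ (e n) (h n) := by
    refine .of_norm_bounded ((summable_geometric_of_lt_one h0.le h1).mul_left C) fun n => ?_
    rw [InnerProductSpace.norm_rankOne, he, one_mul]
    exact hh n
  refine ⟨∑' n, InnerProductSpace.rankOne ℂ (e n) (h n), fun x n => ?_⟩
  have h2 : HasSum (fun m => inner ℂ (e n) (InnerProductSpace.rankOne ℂ (e m) (h m) x))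
      (inner ℂ (e n) ((∑' n, InnerProductSpace.rankOne ℂ (e n) (h n)) x)) :=
    (hsum.hasSum.mapL (ContinuousLinearMap.apply ℂ L2 x)).mapL (innerSL ℂ (e n))
  have h3 : ∀ y : L2, inner ℂ (e n) y = y n := fun y => by simp [e, lp.inner_single_left]
  rw [h3] at h2
  refine h2.unique ?_
  have h4 := hasSum_single (f := fun m =>
    inner ℂ (e n) (InnerProductSpace.rankOne ℂ (e m) (h m) x)) n (fun m hm => by
      rw [h3]
      simp [e, lp.single_apply, hm.symm])
  convert h4 using 1
  rw [h3]
  simp [e]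

/-- With `W` the Hankel operator with entries `w (n + k)`, the operator `1 + W W*` is invertible
because it is bounded below by `1`; the equation solved here is `p + W W* p = e₀`, with
`s = W* p`. -/
lemma exists_hankel_solution {w : ℕ → ℂ} {C ρ : ℝ} (h0 : 0 < ρ) (h1 : ρ < 1)
    (hw : ∀ n, ‖w n‖ ≤ C * ρ ^ n) :
    ∃ (p s : ℕ → ℂ) (D : ℝ), (∀ n, ‖p n‖ ≤ D * ρ ^ n) ∧ (∀ n, ‖s n‖ ≤ D * ρ ^ n) ∧
      (∀ n, HasSum (fun k => w (n + k) * s k) ((if n = 0 then 1 else 0) - p n)) ∧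
      ∀ k, HasSum (fun n => conj (w (k + n)) * p n) (s k) := by
  obtain ⟨h, K, hh, hK⟩ := exists_rows h0 h1 hw
  obtain ⟨W, hW⟩ := exists_operator_of_rows h0 h1 hK
  let e : ℕ → L2 := fun n => lp.single 2 n 1
  have h3 : ∀ n (y : L2), inner ℂ (e n) y = y n := fun n y => by simp [e, lp.inner_single_left]
  have hunit : IsUnit (1 + W * star W) :=
    CStarAlgebra.isUnit_of_le (1 : L2 →L[ℂ] L2)
      (le_add_of_nonneg_right (mul_star_self_nonneg W))
  obtain ⟨T, hT⟩ := hunit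
  let p : L2 := (↑T⁻¹ : L2 →L[ℂ] L2) (e 0)
  let s : L2 := star W p
  have hps : p + W s = e 0 := by
    have h4 : (T : L2 →L[ℂ] L2) ((↑T⁻¹ : L2 →L[ℂ] L2) (e 0)) = e 0 := by
      rw [← mul_apply_eq_comp, T.mul_inv, one_apply_eq_self]
    rw [hT] at h4
    exact h4
  have hp : ∀ n, inner ℂ (h n) s = (if n = 0 then 1 else 0) - p n := fun n => by
    have h4 : p n + W s n = e 0 n := by rw [← hps]; rfl
    rw [hW] at h4
    rw [eq_sub_iff_add_eq, add_comm, h4]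
    simp [e, lp.single_apply, Pi.single_apply]
  have hWe : ∀ k n, W (e k) n = w (n + k) := fun k n => by
    rw [hW, ← inner_conj_symm, h3, hh, Complex.conj_conj]
  have hs : ∀ k, HasSum (fun n => conj (w (k + n)) * p n) (s k) := fun k => by
    have h4 : s k = inner ℂ (W (e k)) p := by
      rw [← h3 k s, ← ContinuousLinearMap.adjoint_inner_right]
      rfl
    rw [h4]
    have h5 := lp.hasSum_inner (𝕜 := ℂ) (G := fun _ : ℕ => ℂ) (W (e k)) p
    simpa [hWe, add_comm, mul_comm] using h5
  -- `p` and `s` inherit the geometric decay of `w` from the two equations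
  have hpb : ∀ n, ‖p n‖ ≤ (1 + K * ‖s‖) * ρ ^ n := fun n => by
    have h4 : p n = (if n = 0 then 1 else 0) - inner ℂ (h n) s := by rw [hp]; ring
    have h5 : ‖(if n = 0 then 1 else 0 : ℂ)‖ ≤ ρ ^ n := by
      split_ifs with hn
      · simp [hn]
      · simpa using pow_nonneg h0.le n
    have h6 : ‖inner ℂ (h n) s‖ ≤ K * ρ ^ n * ‖s‖ :=
      (norm_inner_le_norm _ _).trans (mul_le_mul_of_nonneg_right (hK n) (norm_nonneg _))
    rw [h4]
    refine (norm_sub_le _ _).trans ?_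
    linarith
  have hC : 0 ≤ C := by simpa using (norm_nonneg _).trans (hw 0)
  have hg := summable_geometric_of_lt_one h0.le h1
  have hsb : ∀ k, ‖s k‖ ≤ (C * (1 + K * ‖s‖) * ∑' n : ℕ, ρ ^ n) * ρ ^ k := fun k => by
    have hK0 : 0 ≤ 1 + K * ‖s‖ := by simpa using (norm_nonneg _).trans (hpb 0)
    rw [← (hs k).tsum_eq]
    have h4 : HasSum (fun n : ℕ => (C * (1 + K * ‖s‖) * ρ ^ k) * ρ ^ n)
        ((C * (1 + K * ‖s‖) * ρ ^ k) * ∑' n : ℕ, ρ ^ n) := hg.hasSum.mul_left _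
    refine (tsum_of_norm_bounded h4 fun n => ?_).trans_eq (by ring)
    rw [norm_mul, RCLike.norm_conj]
    have hp1 : ‖p n‖ ≤ 1 + K * ‖s‖ :=
      (hpb n).trans (mul_le_of_le_one_right hK0 (pow_le_one₀ h0.le h1.le))
    calc ‖w (k + n)‖ * ‖p n‖ ≤ (C * ρ ^ (k + n)) * (1 + K * ‖s‖) :=
          mul_le_mul (hw _) hp1 (norm_nonneg _) (by positivity)
      _ = _ := by ring
  refine ⟨p, s, max (1 + K * ‖s‖) (C * (1 + K * ‖s‖) * ∑' n : ℕ, ρ ^ n), fun n => ?_, fun n => ?_,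
    fun n => ?_, hs⟩
  · exact (hpb n).trans (mul_le_mul_of_nonneg_right (le_max_left _ _) (by positivity))
  · exact (hsb n).trans (mul_le_mul_of_nonneg_right (le_max_right _ _) (by positivity))
  · have h4 := lp.hasSum_inner (𝕜 := ℂ) (G := fun _ : ℕ => ℂ) (h n) s
    rw [hp] at h4
    simpa [hh, mul_comm] using h4

/-- Summation over the diagonals `m - k = n ≥ 0` and `m - k = -(j + 1) < 0` of `ℕ × ℕ`. -/
lemma hasSum_of_diagonals {f : ℕ × ℕ → ℂ} {a b : ℂ}
    (s₁ : HasSum (fun x : ℕ × ℕ => f (x.1 + x.2, x.2)) a)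
    (s₂ : HasSum (fun x : ℕ × ℕ => f (x.2, x.2 + 1 + x.1)) b) : HasSum f (a + b) := by
  let g₁ : ℕ × ℕ → ℕ × ℕ := fun x => (x.1 + x.2, x.2)
  let g₂ : ℕ × ℕ → ℕ × ℕ := fun x => (x.2, x.2 + 1 + x.1)
  have hg₁ : g₁.Injective := by
    rintro ⟨a, b⟩ ⟨c, d⟩ h
    simp only [g₁, Prod.mk.injEq] at h ⊢
    omega
  have hg₂ : g₂.Injective := by
    rintro ⟨a, b⟩ ⟨c, d⟩ h
    simp only [g₂, Prod.mk.injEq] at h ⊢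
    omega
  have hcompl : IsCompl (range g₁) (range g₂) := by
    refine ⟨Set.disjoint_left.2 ?_, codisjoint_iff.2 ?_⟩
    · rintro _ ⟨⟨a, b⟩, rfl⟩ ⟨⟨c, d⟩, h⟩
      simp only [g₁, g₂, Prod.mk.injEq] at h
      omega
    · refine Set.eq_univ_of_forall ?_
      rintro ⟨a, b⟩
      rcases le_or_gt b a with h | h
      · exact Or.inl ⟨(a - b, b), by simp only [g₁, Nat.sub_add_cancel h]⟩
      · exact Or.inr ⟨(b - a - 1, a), by simp only [g₂, Prod.mk.injEq, true_and]; omega⟩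
  exact HasSum.add_isCompl hcompl ((hg₁.hasSum_range_iff).2 s₁) ((hg₂.hasSum_range_iff).2 s₂)

lemma tsum_mul_tsum_conj {w s c b : ℕ → ℂ} {z : ℂ} (hz : z ∈ unitCircle)
    (n1 : Summable fun m => ‖w m * z ^ m‖) (n2 : Summable fun m => ‖s m * (conj z) ^ m‖)
    (hc : ∀ n, HasSum (fun k => w (n + k) * s k) (c n))
    (hb : ∀ j, HasSum (fun m => w m * s (m + 1 + j)) (b j)) :
    (∑' m, w m * z ^ m) * (∑' k, s k * (conj z) ^ k) =
      (∑' n, c n * z ^ n) + conj z * ∑' j, b j * (conj z) ^ j := by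
  have hpow : ∀ k : ℕ, z ^ k * (conj z) ^ k = 1 := fun k => by
    rw [← mul_pow, mul_conj_of_mem_unitCircle hz, one_pow]
  have hf : Summable (fun x : ℕ × ℕ => (w x.1 * z ^ x.1) * (s x.2 * (conj z) ^ x.2)) :=
    summable_mul_of_summable_norm (f := fun m => w m * z ^ m) (g := fun m => s m * (conj z) ^ m)
      n1 n2
  rw [tsum_mul_tsum_of_summable_norm n1 n2]
  refine (hasSum_of_diagonals ?_ ?_).tsum_eq
  · have h2 := (hf.comp_injective (i := fun x : ℕ × ℕ => (x.1 + x.2, x.2)) fun x y h => by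
      simp only [Prod.mk.injEq] at h; ext <;> omega).hasSum
    have h3 : ∀ n, HasSum (fun k => (w (n + k) * z ^ (n + k)) * (s k * (conj z) ^ k))
        (c n * z ^ n) := fun n => by
      have e : (fun k => (w (n + k) * z ^ (n + k)) * (s k * (conj z) ^ k)) =
          fun k => w (n + k) * s k * z ^ n := by
        funext k
        rw [pow_add]
        linear_combination (w (n + k) * s k * z ^ n) * hpow k
      rw [e]
      exact (hc n).mul_right (z ^ n)
    rw [(h2.prod_fiberwise h3).tsum_eq]
    exact h2
  · have h2 := (hf.comp_injective (i := fun x : ℕ × ℕ => (x.2, x.2 + 1 + x.1)) fun x y h => by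
      simp only [Prod.mk.injEq] at h; ext <;> omega).hasSum
    have h3 : ∀ j, HasSum (fun m => (w m * z ^ m) * (s (m + 1 + j) * (conj z) ^ (m + 1 + j)))
        (conj z * (b j * (conj z) ^ j)) := fun j => by
      have e : (fun m => (w m * z ^ m) * (s (m + 1 + j) * (conj z) ^ (m + 1 + j))) =
          fun m => conj z * (w m * s (m + 1 + j) * (conj z) ^ j) := by
        funext m
        rw [pow_add, pow_add, pow_one]
        linear_combination (conj z * (w m * s (m + 1 + j) * (conj z) ^ j)) * hpow m
      rw [e]
      exact ((hb j).mul_right ((conj z) ^ j)).mul_left (conj z)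
    rw [← tsum_mul_left, (h2.prod_fiberwise h3).tsum_eq]
    exact h2

/-- The product of a power series in `z` and one in `conj z`, sorted by frequencies. -/
lemma exists_product_splitting {w s c : ℕ → ℂ} {C D ρ : ℝ} (h0 : 0 < ρ) (h1 : ρ < 1)
    (hw : ∀ n, ‖w n‖ ≤ C * ρ ^ n) (hs : ∀ n, ‖s n‖ ≤ D * ρ ^ n)
    (hc : ∀ n, HasSum (fun k => w (n + k) * s k) (c n)) :
    ∃ (b : ℕ → ℂ) (B : ℝ), (∀ n, ‖b n‖ ≤ B * ρ ^ n) ∧ ∀ z ∈ unitCircle,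
      (∑' m, w m * z ^ m) * (∑' k, s k * (conj z) ^ k) =
        (∑' n, c n * z ^ n) + conj z * ∑' j, b j * (conj z) ^ j := by
  have hC : 0 ≤ C := by simpa using (norm_nonneg _).trans (hw 0)
  have hD : 0 ≤ D := by simpa using (norm_nonneg _).trans (hs 0)
  have hg := summable_geometric_of_lt_one h0.le h1
  have hbnd : ∀ j m, ‖w m * s (m + 1 + j)‖ ≤ (C * D * ρ ^ j) * ρ ^ m := fun j m => by
    rw [norm_mul]
    calc ‖w m‖ * ‖s (m + 1 + j)‖ ≤ (C * ρ ^ m) * (D * ρ ^ (m + 1 + j)) :=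
          mul_le_mul (hw _) (hs _) (norm_nonneg _) (by positivity)
      _ = (C * D * ρ ^ j) * ρ ^ m * ρ ^ (m + 1) := by ring
      _ ≤ _ := mul_le_of_le_one_right (by positivity) (pow_le_one₀ h0.le h1.le)
  have hbs : ∀ j, Summable fun m => w m * s (m + 1 + j) := fun j =>
    Summable.of_norm_bounded (hg.mul_left (C * D * ρ ^ j)) (hbnd j)
  refine ⟨fun j => ∑' m, w m * s (m + 1 + j), C * D * ∑' m : ℕ, ρ ^ m, fun j => ?_, fun z hz => ?_⟩
  · refine (tsum_of_norm_bounded (hg.hasSum.mul_left (C * D * ρ ^ j)) (hbnd j)).trans_eq ?_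
    ring
  have hzD : z ∈ closedDisk := unitCircle_subset_closedDisk hz
  have hzD' : conj z ∈ closedDisk := by
    rw [mem_closedBall_zero_iff, RCLike.norm_conj]
    exact mem_closedBall_zero_iff.1 hzD
  exact tsum_mul_tsum_conj hz
    (Summable.of_nonneg_of_le (fun _ => norm_nonneg _) (norm_mul_pow_le hw hzD) (hg.mul_left C))
    (Summable.of_nonneg_of_le (fun _ => norm_nonneg _) (norm_mul_pow_le hs hzD') (hg.mul_left D))
    hc (fun j => (hbs j).hasSum)

/-! ### Spectral factorization of positive definite loops -/

lemma conj_tsum_coeff (c : ℕ → ℂ) (z : ℂ) :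
    conj (∑' n, c n * z ^ n) = ∑' n, conj (c n) * (conj z) ^ n := by
  rw [conj_tsum]
  simp

/-- The functions `p`, `q` make the rows of
`!![p, -conj q; q, conj p] * !![1, conj w; 0, 1]` holomorphic in the disk. -/
lemma exists_hankel_pair {w : ℂ → ℂ} (hw : AnalyticOnNhd ℂ w closedDisk) :
    ∃ p q a b : ℂ → ℂ, AnalyticOnNhd ℂ p closedDisk ∧ AnalyticOnNhd ℂ q closedDisk ∧
      AnalyticOnNhd ℂ a closedDisk ∧ AnalyticOnNhd ℂ b closedDisk ∧ a 0 = 1 ∧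
      ∀ z ∈ unitCircle, conj (p z) + q z * conj (w z) = a z ∧
        conj (q z) - p z * conj (w z) = b z := by
  obtain ⟨c, C, ρ, h0, h1, hc, hwc⟩ := exists_coeff hw
  obtain ⟨p, s, D, hp, hs, e₁, e₂⟩ := exists_hankel_solution h0 h1 hc
  have hp' : ∀ n, ‖conj (p n)‖ ≤ D * ρ ^ n := fun n => by rw [RCLike.norm_conj]; exact hp n
  have hs' : ∀ n, ‖conj (s n)‖ ≤ D * ρ ^ n := fun n => by rw [RCLike.norm_conj]; exact hs n
  have e₂' : ∀ n, HasSum (fun k => c (n + k) * conj (p k)) (conj (s n)) := fun n => by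
    have := (e₂ n).map (starRingEnd ℂ) continuous_conj
    simpa [Function.comp_def] using this
  -- the Hankel equation prescribes the part of `w * conj q` with frequencies `≥ 0` to be `1 - p`, and
  -- that of `w * conj p` to be `q`; the negative frequencies make up `conj (a - 1)` and `-conj b`
  obtain ⟨b₁, B₁, hb₁, f₁⟩ := exists_product_splitting h0 h1 hc hs e₁
  obtain ⟨b₂, B₂, hb₂, f₂⟩ := exists_product_splitting h0 h1 hc hp' e₂'
  have hb₁' : ∀ n, ‖conj (b₁ n)‖ ≤ B₁ * ρ ^ n := fun n => by rw [RCLike.norm_conj]; exact hb₁ n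
  have hb₂' : ∀ n, ‖conj (b₂ n)‖ ≤ B₂ * ρ ^ n := fun n => by rw [RCLike.norm_conj]; exact hb₂ n
  refine ⟨fun z => ∑' n, p n * z ^ n, fun z => ∑' n, conj (s n) * z ^ n,
    fun z => 1 + z * ∑' n, conj (b₁ n) * z ^ n, fun z => -(z * ∑' n, conj (b₂ n) * z ^ n),
    analyticOnNhd_tsum_coeff h0 h1 hp, analyticOnNhd_tsum_coeff h0 h1 hs',
    analyticOnNhd_const.add (analyticOnNhd_id.mul (analyticOnNhd_tsum_coeff h0 h1 hb₁')),
    (analyticOnNhd_id.mul (analyticOnNhd_tsum_coeff h0 h1 hb₂')).neg, by simp, fun z hz => ?_⟩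
  have hzD : z ∈ closedDisk := unitCircle_subset_closedDisk hz
  have hwz : w z = ∑' n, c n * z ^ n := (hwc z hzD).tsum_eq.symm
  have hsub : (∑' n, ((if n = 0 then 1 else 0) - p n) * z ^ n) = 1 - ∑' n, p n * z ^ n := by
    have h2 : HasSum (fun n => (if n = 0 then 1 else 0 : ℂ) * z ^ n) 1 := by
      have h3 := hasSum_single (f := fun n => (if n = 0 then 1 else 0 : ℂ) * z ^ n) 0
        (fun n hn => by simp [hn])
      simpa using h3
    have h4 := h2.sub (summable_coeff h0 h1 hp hzD).hasSum
    rw [← h4.tsum_eq]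
    exact tsum_congr fun n => by ring
  have g₁ := congrArg conj (f₁ z hz)
  have g₂ := congrArg conj (f₂ z hz)
  rw [hsub, ← hwz] at g₁
  rw [← hwz] at g₂
  simp only [map_mul, map_add, map_sub, map_one, conj_tsum_coeff, Complex.conj_conj] at g₁ g₂ ⊢
  constructor
  · linear_combination g₁
  · linear_combination -g₂

/-- Spectral factorization of `Tᴴ T` for the unipotent `T = !![1, conj w; 0, 1]`: the constant
`|p|² + |q|²` makes a multiple of `!![p, -conj q; q, conj p]` unitary on the circle, and it carries
`T` to a holomorphic matrix. -/
lemma exists_factor_unipotent {w : ℂ → ℂ} (hw : AnalyticOnNhd ℂ w closedDisk) :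
    ∃ a b c d : ℂ → ℂ, AnalyticOnNhd ℂ a closedDisk ∧ AnalyticOnNhd ℂ b closedDisk ∧
      AnalyticOnNhd ℂ c closedDisk ∧ AnalyticOnNhd ℂ d closedDisk ∧
      (∀ z ∈ closedDisk, a z * d z - b z * c z = 1) ∧
      ∀ z ∈ unitCircle, (!![a z, b z; c z, d z]).conjTranspose * !![a z, b z; c z, d z] =
        !![1, conj (w z); w z, 1 + w z * conj (w z)] := by
  obtain ⟨p, q, A, B, hp, hq, hA, hB, hA0, h⟩ := exists_hankel_pair hw
  -- `|p|² + |q|²` is the boundary value of the holomorphic `p A + q B`, hence constant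
  have hreal : ∀ z ∈ unitCircle, p z * A z + q z * B z = p z * conj (p z) + q z * conj (q z) :=
    fun z hz => by rw [← (h z hz).1, ← (h z hz).2]; ring
  have hreal' : ∀ z ∈ unitCircle, p z * A z + q z * B z = (normSq (p z) + normSq (q z) : ℝ) :=
    fun z hz => by rw [hreal z hz, mul_conj, mul_conj]; push_cast; rfl
  obtain ⟨κ, hκ⟩ := exists_eq_const_of_real (f := fun z => p z * A z + q z * B z)
    ((hp.mul hA).add (hq.mul hB)) (fun z hz => by rw [hreal' z hz, ofReal_im])
  have hκ' : ∀ z ∈ unitCircle, normSq (p z) + normSq (q z) = κ := fun z hz => by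
    have := hreal' z hz
    rw [hκ z (unitCircle_subset_closedDisk hz)] at this
    exact_mod_cast this.symm
  have hκ0 : 0 < κ := by
    refine lt_of_le_of_ne ?_ ?_
    · rw [← hκ' 1 (by simp)]
      exact add_nonneg (normSq_nonneg _) (normSq_nonneg _)
    · rintro rfl
      -- otherwise `p`, `q` and hence `A` vanish on the circle, against `A 0 = 1`
      have hA1 : ∀ z ∈ unitCircle, A z = 0 := fun z hz => by
        have h1 : normSq (p z) = 0 := by
          linarith [hκ' z hz, normSq_nonneg (p z), normSq_nonneg (q z)]
        have h2 : normSq (q z) = 0 := by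
          linarith [hκ' z hz, normSq_nonneg (p z), normSq_nonneg (q z)]
        rw [← (h z hz).1, normSq_eq_zero.1 h1, normSq_eq_zero.1 h2]
        simp
      obtain ⟨e, he⟩ := exists_eq_const_of_real hA (fun z hz => by rw [hA1 z hz, zero_im])
      have h1 := he 0 (by simp)
      have h2 := he 1 (by simp)
      rw [hA1 1 (by simp)] at h2
      rw [hA0, ← h2] at h1
      exact one_ne_zero h1
  set r : ℂ := (((Real.sqrt κ)⁻¹ : ℝ) : ℂ) with hr
  have hrr : r * r * κ = 1 := by
    rw [hr, ← ofReal_mul, ← ofReal_mul, ← mul_inv, Real.mul_self_sqrt hκ0.le,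
      inv_mul_cancel₀ hκ0.ne', ofReal_one]
  have hrc : conj r = r := conj_ofReal _
  refine ⟨fun z => r * p z, fun z => r * -B z, fun z => r * q z, fun z => r * A z,
    analyticOnNhd_const.mul hp, analyticOnNhd_const.mul hB.neg, analyticOnNhd_const.mul hq,
    analyticOnNhd_const.mul hA, fun z hz => ?_, fun z hz => ?_⟩
  · have := hκ z hz
    linear_combination r * r * this + hrr
  · have h1 := hreal z hz
    rw [hκ z (unitCircle_subset_closedDisk hz)] at h1
    obtain ⟨h2, h3⟩ := h z hz
    dsimp only
    rw [← h2, ← h3]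
    ext i j
    fin_cases i <;> fin_cases j <;>
      simp [Matrix.mul_apply, Fin.sum_univ_two, Matrix.conjTranspose_apply, hrc]
    · linear_combination hrr - r * r * h1
    · linear_combination conj (w z) * (hrr - r * r * h1)
    · linear_combination (w z) * (hrr - r * r * h1)
    · linear_combination (1 + w z * conj (w z)) * (hrr - r * r * h1)

/-- Scalar spectral factorization, by splitting the logarithm. -/
lemma exists_scalar_factor {f : ℂ → ℂ} (hf : AnalyticOnNhd ℂ f unitCircle)
    (hpos : ∀ z ∈ unitCircle, 0 < (f z).re ∧ (f z).im = 0) :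
    ∃ α : ℂ → ℂ, AnalyticOnNhd ℂ α closedDisk ∧ (∀ z, α z ≠ 0) ∧
      ∀ z ∈ unitCircle, f z = conj (α z) * α z := by
  have hlog : AnalyticOnNhd ℂ (fun z => log (f z)) unitCircle := fun z hz =>
    (hf z hz).clog (Or.inl (hpos z hz).1)
  obtain ⟨u, w, hu, hw, huw⟩ := exists_splitting hlog
  refine ⟨fun z => exp ((u z + w z) / 2), ?_, fun z => exp_ne_zero _, fun z hz => ?_⟩
  · exact fun z hz => (((hu z hz).add (hw z hz)).div analyticAt_const two_ne_zero).cexp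
  · have hp := hpos z hz
    have h1 : conj (log (f z)) = log (f z) := by
      have h2 : f z = ((f z).re : ℝ) := Complex.ext rfl (by simp [hp.2])
      rw [h2, ← ofReal_log hp.1.le, conj_ofReal]
    have h2 := huw z hz
    have h3 : log (f z) = conj (u z) + w z := by
      rw [← h1, h2, map_add, Complex.conj_conj]
    rw [← exp_conj, ← exp_add]
    have h4 : conj ((u z + w z) / 2) + (u z + w z) / 2 = log (f z) := by
      simp only [map_div₀, map_add, map_ofNat]
      linear_combination (-1 / 2) * h2 - (1 / 2) * h3
    rw [h4, exp_log]
    intro h0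
    rw [h0] at hp
    exact lt_irrefl _ hp.1

open scoped ComplexOrder Matrix

/-- Entrywise analyticity of a matrix valued function near every point of `S`. -/
def MatAnalytic (S : Set ℂ) (F : ℂ → Mat2) : Prop :=
  ∀ i j, AnalyticOnNhd ℂ (fun z => F z i j) S

namespace MatAnalytic

variable {S T : Set ℂ} {F G : ℂ → Mat2}

lemma mono (hF : MatAnalytic T F) (h : S ⊆ T) : MatAnalytic S F := fun i j => (hF i j).mono h

lemma const (A : Mat2) : MatAnalytic S fun _ => A := fun _ _ => analyticOnNhd_const

lemma of_entries {a b c d : ℂ → ℂ} (ha : AnalyticOnNhd ℂ a S) (hb : AnalyticOnNhd ℂ b S)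
    (hc : AnalyticOnNhd ℂ c S) (hd : AnalyticOnNhd ℂ d S) :
    MatAnalytic S fun z => !![a z, b z; c z, d z] := by
  intro i j
  fin_cases i <;> fin_cases j <;> simpa

lemma mul (hF : MatAnalytic S F) (hG : MatAnalytic S G) : MatAnalytic S fun z => F z * G z := by
  intro i j
  simp only [Matrix.mul_apply, Fin.sum_univ_two]
  exact ((hF i 0).mul (hG 0 j)).add ((hF i 1).mul (hG 1 j))

lemma add (hF : MatAnalytic S F) (hG : MatAnalytic S G) : MatAnalytic S fun z => F z + G z :=
  fun i j => (hF i j).add (hG i j)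

lemma sub (hF : MatAnalytic S F) (hG : MatAnalytic S G) : MatAnalytic S fun z => F z - G z :=
  fun i j => (hF i j).sub (hG i j)

lemma smul {f : ℂ → ℂ} (hf : AnalyticOnNhd ℂ f S) (hF : MatAnalytic S F) :
    MatAnalytic S fun z => f z • F z :=
  fun i j => hf.mul (hF i j)

lemma det (hF : MatAnalytic S F) : AnalyticOnNhd ℂ (fun z => (F z).det) S := by
  simp only [Matrix.det_fin_two]
  exact ((hF 0 0).mul (hF 1 1)).sub ((hF 0 1).mul (hF 1 0))

lemma trace (hF : MatAnalytic S F) : AnalyticOnNhd ℂ (fun z => (F z).trace) S := by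
  simp only [Matrix.trace_fin_two]
  exact (hF 0 0).add (hF 1 1)

lemma adjugate (hF : MatAnalytic S F) : MatAnalytic S fun z => (F z).adjugate := by
  simp only [Matrix.adjugate_fin_two]
  exact of_entries (hF 1 1) (hF 0 1).neg (hF 1 0).neg (hF 0 0)

lemma continuousOn (hF : MatAnalytic S F) : ContinuousOn F S :=
  continuousOn_pi.2 fun i => continuousOn_pi.2 fun j => (hF i j).continuousOn

end MatAnalytic

/-- Spectral factorization of positive definite loops: after scalar spectral factorizations of the
upper left entry and of the determinant, only a unipotent factor remains. -/
theorem exists_factor_of_posDef {X : ℂ → Mat2} (hX : MatAnalytic unitCircle X)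
    (hpos : ∀ z ∈ unitCircle, (X z).PosDef) :
    ∃ Y : ℂ → Mat2, MatAnalytic closedDisk Y ∧ (∀ z ∈ closedDisk, (Y z).det ≠ 0) ∧
      ∀ z ∈ unitCircle, (Y z)ᴴ * Y z = X z := by
  obtain ⟨α, hα, hα0, hαX⟩ := exists_scalar_factor (hX 0 0) fun z hz => by
    have := Complex.pos_iff.1 ((hpos z hz).diag_pos (i := 0))
    exact ⟨this.1, this.2.symm⟩
  obtain ⟨δ, hδ, hδ0, hδX⟩ := exists_scalar_factor hX.det fun z hz => by
    have := Complex.pos_iff.1 (hpos z hz).det_pos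
    exact ⟨this.1, this.2.symm⟩
  have hX0 : ∀ z ∈ unitCircle, X z 0 0 ≠ 0 := fun z hz => (hpos z hz).diag_pos.ne'
  have hαc := hα.mono unitCircle_subset_closedDisk
  have hδc := hδ.mono unitCircle_subset_closedDisk
  -- `X = Tᴴ T` with `T = !![1, φ; 0, 1] * diag (α, δ / α)` and `φ = X₀₁ α / (conj α * δ)`; here
  -- `conj α` is eliminated by means of `X₀₀ = conj α * α`
  have hφ : AnalyticOnNhd ℂ (fun z => X z 0 1 * α z ^ 2 / (X z 0 0 * δ z)) unitCircle :=
    ((hX 0 1).mul (hαc.pow 2)).div ((hX 0 0).mul hδc)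
      fun z hz => mul_ne_zero (hX0 z hz) (hδ0 z)
  obtain ⟨u, w, hu, hw, huw⟩ := exists_splitting hφ
  obtain ⟨a, b, c, d, ha, hb, hc, hd, hdet, hV⟩ := exists_factor_unipotent hw
  have hγ : AnalyticOnNhd ℂ (fun z => δ z / α z) closedDisk := hδ.div hα fun z _ => hα0 z
  -- the holomorphic part `u` of `φ = u + conj w` may stay on the right
  refine ⟨fun z => !![a z, b z; c z, d z] * !![α z, u z * (δ z / α z); 0, δ z / α z],
    (MatAnalytic.of_entries ha hb hc hd).mul
      (MatAnalytic.of_entries hα (hu.mul hγ) analyticOnNhd_const hγ), fun z hz => ?_,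
    fun z hz => ?_⟩
  · rw [Matrix.det_mul, Matrix.det_fin_two_of, Matrix.det_fin_two_of, hdet z hz]
    have := hα0 z
    field_simp
    simp [hδ0 z, this]
  · have e₁ := hαX z hz
    have e₂ := hδX z hz
    have hα1 : conj (α z) ≠ 0 := by simpa using hα0 z
    have e₃ : u z * (δ z / α z) + conj (w z) * (δ z / α z) = X z 0 1 / conj (α z) := by
      rw [← add_mul, ← huw z hz, e₁]
      have := hα0 z
      have := hδ0 z
      field_simp
    have e₃' := congrArg conj e₃
    have e₄ : X z 1 0 = conj (X z 0 1) := ((hpos z hz).isHermitian.apply 1 0).symm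
    rw [Matrix.det_fin_two, e₄, e₁] at e₂
    simp only [map_add, map_mul, map_div₀, Complex.conj_conj] at e₃'
    rw [Matrix.conjTranspose_mul, Matrix.mul_assoc, ← Matrix.mul_assoc _ _ !![α z, _; _, _],
      hV z hz]
    have hα2 := hα0 z
    ext i j
    fin_cases i <;> fin_cases j <;>
      simp [Matrix.mul_apply, Fin.sum_univ_two, Matrix.conjTranspose_apply]
    · exact e₁.symm
    · rw [e₃]
      field_simp
    · rw [e₄]
      have : conj (X z 0 1) = (conj (u z) * (conj (δ z) / conj (α z)) +
        w z * (conj (δ z) / conj (α z))) * α z := by rw [e₃']; field_simp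
      rw [this]
      ring
    · have h5 : X z 1 1 = (X z 0 1 / conj (α z)) * (conj (X z 0 1) / α z)
          + (conj (δ z) / conj (α z)) * (δ z / α z) := by
        field_simp
        linear_combination e₂
      rw [h5, ← e₃, ← e₃']
      ring

/-! ### Spectral factorization of positive semidefinite loops -/

lemma isClosed_posSemidef : IsClosed {A : Mat2 | A.PosSemidef} := by
  simp only [Matrix.posSemidef_iff_dotProduct_mulVec, Matrix.IsHermitian, ofPred_and, ofPred_forall]
  refine (isClosed_eq (by fun_prop) continuous_id).inter (isClosed_iInter fun x => ?_)
  exact isClosed_Ici.preimage (f := fun A : Mat2 => star x ⬝ᵥ A.mulVec x) (by fun_prop)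

/-- A function that is nonnegative on the circle has vanishing derivative at each of its zeros
there. -/
lemma deriv_eq_zero_of_nonneg {f : ℂ → ℂ} {a : ℂ} (hf : AnalyticAt ℂ f a) (ha : a ∈ unitCircle)
    (h : ∀ z ∈ unitCircle, 0 ≤ f z) (hfa : f a = 0) : deriv f a = 0 := by
  -- along the circle the real part has a minimum at `a`, and the imaginary part vanishes
  let γ : ℂ → ℂ := fun s => a * exp (s * I)
  have hγ0 : γ 0 = a := by simp [γ]
  have hγc : ∀ t : ℝ, γ t ∈ unitCircle := fun t => by
    rw [mem_unitCircle, norm_mul, norm_exp_ofReal_mul_I, mem_unitCircle.1 ha, mul_one]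
  have hγd : HasDerivAt γ (a * I) 0 := by
    have h1 : HasDerivAt (fun s : ℂ => exp (s * I)) (exp (0 * I) * (1 * I)) 0 :=
      ((hasDerivAt_id (0 : ℂ)).mul_const I).cexp
    simpa using h1.const_mul a
  have hF : HasDerivAt (fun s => f (γ s)) (deriv f a * (a * I)) ((0 : ℝ) : ℂ) := by
    have h1 : HasDerivAt f (deriv f a) (γ 0) := by
      rw [hγ0]; exact hf.differentiableAt.hasDerivAt
    rw [ofReal_zero]
    exact h1.comp (0 : ℂ) hγd
  have hre : (deriv f a * (a * I)).re = 0 := by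
    refine IsLocalMin.hasDerivAt_eq_zero (f := fun t : ℝ => (f (γ t)).re) (a := 0)
      (Eventually.of_forall fun t => ?_) hF.real_of_complex
    have := (Complex.nonneg_iff.1 (h _ (hγc t))).1
    simpa [hγ0, hfa] using this
  have him : (deriv f a * (a * I)).im = 0 := by
    have h2 := (hF.const_mul I).real_of_complex
    have h3 : (fun t : ℝ => (I * f (γ t)).re) = fun _ => 0 := by
      funext t
      simp [← (Complex.nonneg_iff.1 (h _ (hγc t))).2]
    rw [h3] at h2
    have h4 := h2.unique (hasDerivAt_const (0 : ℝ) (0 : ℝ))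
    simp only [mul_re, mul_im, I_re, I_im] at h4 ⊢
    linear_combination -h4
  have h5 : deriv f a * (a * I) = 0 := Complex.ext hre him
  have h6 : a * I ≠ 0 := mul_ne_zero (ne_zero_of_mem_unitCircle ha) I_ne_zero
  exact (mul_eq_zero.1 h5).resolve_right h6

lemma HasZeroDegree.mul_of_ne_zero {S : Set ℂ} {f v : ℂ → ℂ} {m : ℕ} (h : HasZeroDegree S f m)
    (hv : AnalyticOnNhd ℂ v S) (hv0 : ∀ z ∈ S, v z ≠ 0) :
    HasZeroDegree S (fun z => v z * f z) m := by
  obtain ⟨P, hP, hPm, u, hu, hu0, hfu⟩ := h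
  refine ⟨P, hP, hPm, fun z => v z * u z, hv.mul hu, fun z hz => mul_ne_zero (hv0 z hz) (hu0 z hz),
    fun z hz => ?_⟩
  simp only [hfu z hz]
  ring

/-- A nonzero vector is the first column of an invertible matrix. -/
lemma exists_invertible_column {v : Fin 2 → ℂ} (hv : v ≠ 0) :
    ∃ Q : Mat2, Q.det ≠ 0 ∧ ∀ i, Q i 0 = v i := by
  refine ⟨!![v 0, -conj (v 1); v 1, conj (v 0)], ?_, fun i => by fin_cases i <;> simp⟩
  rw [Matrix.det_fin_two_of, neg_mul, sub_neg_eq_add, mul_conj, mul_comm (conj _), mul_conj,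
    ← ofReal_add, ofReal_ne_zero]
  intro h0
  have h1 : normSq (v 0) = 0 := by linarith [normSq_nonneg (v 0), normSq_nonneg (v 1)]
  have h2 : normSq (v 1) = 0 := by linarith [normSq_nonneg (v 0), normSq_nonneg (v 1)]
  refine hv (funext fun i => ?_)
  fin_cases i
  · exact normSq_eq_zero.1 h1
  · exact normSq_eq_zero.1 h2

lemma conj_sub_of_mem_unitCircle {z a : ℂ} (hz : z ∈ unitCircle) (ha : a ∈ unitCircle) :
    (z - a) = -(z * a) * conj (z - a) := by
  have h1 := mul_conj_of_mem_unitCircle hz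
  have h2 := mul_conj_of_mem_unitCircle ha
  rw [map_sub]
  linear_combination a * h1 - z * h2

/-- A positive semidefinite loop whose first column vanishes at a point `a` of the circle is
`Dᴴ * X' * D` with `D = diag (z - a, 1)` and `X'` again analytic and positive semidefinite. -/
lemma exists_deflation {X : ℂ → Mat2} (hX : MatAnalytic unitCircle X)
    (hpos : ∀ z ∈ unitCircle, (X z).PosSemidef) {a : ℂ} (ha : a ∈ unitCircle)
    (h0 : ∀ i, X a i 0 = 0) :
    ∃ X' : ℂ → Mat2, MatAnalytic unitCircle X' ∧ (∀ z ∈ unitCircle, (X' z).PosSemidef) ∧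
      ∀ z ∈ unitCircle, X z = (!![z - a, 0; 0, 1] : Mat2)ᴴ * X' z * !![z - a, 0; 0, 1] := by
  have hherm : ∀ z ∈ unitCircle, ∀ i j, X z i j = conj (X z j i) := fun z hz i j =>
    ((hpos z hz).isHermitian.apply i j).symm
  -- the diagonal entry is nonnegative, so that it has a double zero, and one factor `z - a` of it can
  -- be traded for `conj (z - a)`, as on the circle their quotient is the unit `-z a`
  have h01 : X a 0 1 = 0 := by rw [hherm a ha, h0, map_zero]
  let g : ℂ → ℂ := dslope (fun z => X z 0 0) a
  have hg : AnalyticOnNhd ℂ g unitCircle := analyticOnNhd_dslope (hX 0 0) ha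
  have hg0 : g a = 0 := by
    simp only [g, dslope_same]
    exact deriv_eq_zero_of_nonneg (hX 0 0 a ha) ha (fun z hz => (hpos z hz).diag_nonneg) (h0 0)
  let h : ℂ → ℂ := dslope g a
  let k : ℂ → ℂ := dslope (fun z => X z 0 1) a
  let l : ℂ → ℂ := dslope (fun z => X z 1 0) a
  have e₀ : ∀ z, X z 0 0 = (z - a) * ((z - a) * h z) := fun z => by
    rw [← sub_mul_dslope hg0 z]
    exact sub_mul_dslope (f := fun z => X z 0 0) (h0 0) z
  have e₁ : ∀ z, X z 0 1 = (z - a) * k z := sub_mul_dslope (f := fun z => X z 0 1) h01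
  have e₂ : ∀ z, X z 1 0 = (z - a) * l z := sub_mul_dslope (f := fun z => X z 1 0) (h0 1)
  let X' : ℂ → Mat2 := fun z => !![-(z * a) * h z, -(z * a) * k z; l z, X z 1 1]
  have hv : AnalyticOnNhd ℂ (fun z : ℂ => -(z * a)) unitCircle :=
    (analyticOnNhd_id.mul analyticOnNhd_const).neg
  have hX' : MatAnalytic unitCircle X' :=
    MatAnalytic.of_entries (hv.mul (analyticOnNhd_dslope hg ha))
      (hv.mul (analyticOnNhd_dslope (hX 0 1) ha)) (analyticOnNhd_dslope (hX 1 0) ha) (hX 1 1)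
  have hXX' : ∀ z ∈ unitCircle,
      X z = (!![z - a, 0; 0, 1] : Mat2)ᴴ * X' z * !![z - a, 0; 0, 1] := by
    intro z hz
    have hc := conj_sub_of_mem_unitCircle hz ha
    ext i j
    fin_cases i <;> fin_cases j <;>
      simp [X', Matrix.mul_apply, Fin.sum_univ_two, Matrix.conjTranspose_apply,
        -map_sub]
    · rw [e₀]
      linear_combination ((z - a) * h z) * hc
    · rw [e₁]
      linear_combination (k z) * hc
    · rw [e₂]
      ring
  refine ⟨X', hX', fun z hz => ?_, hXX'⟩
  -- away from `a` positivity is inherited by congruence, at `a` by continuity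
  refine mem_of_finite_exception hX'.continuousOn isClosed_posSemidef (finite_singleton a)
    (fun y hy => ?_) hz
  have hya : y - a ≠ 0 := sub_ne_zero.2 hy.2
  have hdet : IsUnit (!![y - a, 0; 0, 1] : Mat2).det := by simpa using hya
  have h1 := (hpos y hy.1).conjTranspose_mul_mul_same (!![y - a, 0; 0, 1] : Mat2)⁻¹
  rw [hXX' y hy.1, Matrix.mul_assoc, Matrix.mul_assoc, Matrix.mul_nonsing_inv _ hdet,
    Matrix.mul_one, ← Matrix.mul_assoc, ← Matrix.conjTranspose_mul,
    Matrix.mul_nonsing_inv _ hdet, Matrix.conjTranspose_one, Matrix.one_mul] at h1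
  exact h1

/-- Spectral factorization of positive semidefinite loops. A zero of the determinant at a point `a`
of the circle is removed by a factor with determinant `z - a`, which does not vanish in the disk. -/
theorem exists_factor_of_posSemidef {X : ℂ → Mat2} (hX : MatAnalytic unitCircle X)
    (hpos : ∀ z ∈ unitCircle, (X z).PosSemidef) (hdet : ∃ z ∈ unitCircle, (X z).det ≠ 0) :
    ∃ Y : ℂ → Mat2, MatAnalytic closedDisk Y ∧ (∀ z ∈ unitDisk, (Y z).det ≠ 0) ∧
      ∀ z ∈ unitCircle, (Y z)ᴴ * Y z = X z := by
  obtain ⟨m, hm⟩ := exists_hasZeroDegree le_rfl hX.det (fun z hz hz' => absurd hz hz') hdet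
  induction m using Nat.strong_induction_on generalizing X with
  | _ m ih =>
  by_cases hz : ∃ a ∈ unitCircle, (X a).det = 0
  swap
  · push Not at hz
    obtain ⟨Y, hY, hY0, hYX⟩ := exists_factor_of_posDef hX fun z hzc =>
      (hpos z hzc).posDef_iff_det_ne_zero.2 (hz z hzc)
    exact ⟨Y, hY, fun z hzc => hY0 z (ball_subset_closedBall hzc), hYX⟩
  obtain ⟨a, ha, hdeta⟩ := hz
  obtain ⟨v, hv, hXv⟩ := Matrix.exists_mulVec_eq_zero_iff.2 hdeta
  obtain ⟨Q, hQ, hQv⟩ := exists_invertible_column hv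
  have hQu : IsUnit Q.det := isUnit_iff_ne_zero.2 hQ
  have hX₁ : MatAnalytic unitCircle fun z => Qᴴ * X z * Q :=
    ((MatAnalytic.const _).mul hX).mul (MatAnalytic.const _)
  obtain ⟨X', hX', hpos', hXX'⟩ := exists_deflation hX₁
    (fun z hz => (hpos z hz).conjTranspose_mul_mul_same Q) ha fun i => by
      have h1 : ∀ j, (X a * Q) j 0 = 0 := fun j => by
        have h2 := congrFun hXv j
        simpa [Matrix.mulVec, dotProduct, Matrix.mul_apply, hQv] using h2
      rw [Matrix.mul_assoc, Matrix.mul_apply, Fin.sum_univ_two, h1, h1]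
      simp
  -- the determinant loses a double zero at `a`, so that the degree drops
  let κ : ℂ := conj Q.det * Q.det
  have hκ : κ ≠ 0 := mul_ne_zero (by simpa using hQ) hQ
  have hdetX : ∀ z ∈ unitCircle,
      (X z).det = (z - a) * ((z - a) * (-(z * a * κ)⁻¹ * (X' z).det)) := by
    intro z hz
    have h1 := congrArg Matrix.det (hXX' z hz)
    simp only [Matrix.det_mul, Matrix.det_conjTranspose, Matrix.det_fin_two_of, mul_one, mul_zero,
      sub_zero, RCLike.star_def] at h1
    have hz0 := ne_zero_of_mem_unitCircle hz
    have ha0 := ne_zero_of_mem_unitCircle ha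
    have hc := conj_sub_of_mem_unitCircle hz ha
    have h2 : (X z).det * κ = conj (z - a) * (X' z).det * (z - a) := by rw [← h1]; ring
    have h3 : conj (z - a) = -(z * a)⁻¹ * (z - a) := by
      field_simp
      linear_combination hc
    rw [h3] at h2
    field_simp
    field_simp at h2
    linear_combination h2
  have hu : AnalyticOnNhd ℂ (fun z => -(z * a * κ)⁻¹) unitCircle := by
    refine AnalyticOnNhd.neg (AnalyticOnNhd.inv ?_ fun z hz => ?_)
    · exact (analyticOnNhd_id.mul analyticOnNhd_const).mul analyticOnNhd_const
    · exact mul_ne_zero (mul_ne_zero (ne_zero_of_mem_unitCircle hz)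
        (ne_zero_of_mem_unitCircle ha)) hκ
  have hf₂ := hu.mul hX'.det
  obtain ⟨m₁, hm₁, hd₁⟩ := hm.of_eq_sub_mul le_rfl ha
    ((analyticOnNhd_id.sub analyticOnNhd_const).mul hf₂) hdetX
  obtain ⟨m₂, hm₂, hd₂⟩ := hd₁.of_eq_sub_mul le_rfl ha hf₂ fun z _ => rfl
  have hd₃ : HasZeroDegree unitCircle (fun z => (X' z).det) m₂ := by
    have h1 := hd₂.mul_of_ne_zero (v := fun z => -(z * a * κ))
      ((analyticOnNhd_id.mul analyticOnNhd_const).mul analyticOnNhd_const).neg fun z hz =>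
        neg_ne_zero.2 (mul_ne_zero (mul_ne_zero (ne_zero_of_mem_unitCircle hz)
          (ne_zero_of_mem_unitCircle ha)) hκ)
    obtain ⟨P, hP, hPm, u, hu, hu0, hfu⟩ := h1
    refine ⟨P, hP, hPm, u, hu, hu0, fun z hz => ?_⟩
    rw [← hfu z hz]
    have hz0 := ne_zero_of_mem_unitCircle hz
    have ha0 := ne_zero_of_mem_unitCircle ha
    simp only
    field_simp
  obtain ⟨Y, hY, hY0, hYX⟩ := ih m₂ (by omega) hX' hpos'
    (by
      obtain ⟨z, hz, hz0⟩ := hdet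
      refine ⟨z, hz, fun h0 => hz0 ?_⟩
      rw [hdetX z hz, h0]
      ring) hd₃
  have hD : MatAnalytic closedDisk fun z => !![z - a, 0; 0, 1] :=
    MatAnalytic.of_entries (analyticOnNhd_id.sub analyticOnNhd_const) analyticOnNhd_const
      analyticOnNhd_const analyticOnNhd_const
  refine ⟨fun z => Y z * !![z - a, 0; 0, 1] * Q⁻¹, (hY.mul hD).mul (MatAnalytic.const _),
    fun z hz => ?_, fun z hz => ?_⟩
  · have hza : z - a ≠ 0 := sub_ne_zero.2 (by
      rintro rfl
      rw [mem_unitCircle] at ha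
      rw [mem_ball_zero_iff] at hz
      linarith)
    rw [Matrix.det_mul, Matrix.det_mul, Matrix.det_nonsing_inv, Ring.inverse_eq_inv']
    exact mul_ne_zero (mul_ne_zero (hY0 z hz) (by simpa using hza)) (inv_ne_zero hQ)
  · calc (Y z * !![z - a, 0; 0, 1] * Q⁻¹)ᴴ * (Y z * !![z - a, 0; 0, 1] * Q⁻¹)
        = (Q⁻¹)ᴴ * ((!![z - a, 0; 0, 1] : Mat2)ᴴ * ((Y z)ᴴ * Y z) * !![z - a, 0; 0, 1]) * Q⁻¹ := by
          simp only [Matrix.conjTranspose_mul, Matrix.mul_assoc]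
      _ = (Q * Q⁻¹)ᴴ * X z * (Q * Q⁻¹) := by
          rw [hYX z hz, ← hXX' z hz]
          simp only [Matrix.conjTranspose_mul, Matrix.mul_assoc]
      _ = X z := by
          rw [Matrix.mul_nonsing_inv _ hQu, Matrix.conjTranspose_one, Matrix.one_mul,
            Matrix.mul_one]

/-! ### Invariant Hermitian forms -/

/-- The trace free part of a matrix. -/
noncomputable def tracelessPart (A : Mat2) : Mat2 := A - (A.trace / 2) • (1 : Mat2)

/-- The commutator of two matrices. -/
def commutator (A B : Mat2) : Mat2 := A * B - B * A

/-- If `A' = X * A * X⁻¹` and `B' = X * B * X⁻¹` for some `X`, then this matrix is a multiple of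
`X`. It is the average of `g' * g⁻¹`, cleared of denominators, over the four elements
`1`, `k`, `a`, `k * a`, where `a` is the trace free part of `A` and `k` is the commutator of
`A` and `B`. As `a` and `k` anticommute, these form a quaternion group up to scalars. -/
noncomputable def intertwiner (A B A' B' : Mat2) : Mat2 :=
  ((commutator A B).det * (tracelessPart A).det) • (1 : Mat2)
    - (tracelessPart A).det • (commutator A' B' * commutator A B)
    - (commutator A B).det • (tracelessPart A' * tracelessPart A)
    + commutator A' B' * tracelessPart A' * (tracelessPart A * commutator A B)

/-- Averaging over the quaternion group maps a matrix to a scalar, as the group acts irreducibly. -/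
lemma quaternion_average {a k : Mat2} (ha : a.trace = 0) (hk : k.trace = 0)
    (hka : (k * a).trace = 0) (Z : Mat2) :
    (k.det * a.det) • Z - a.det • (k * Z * k) - k.det • (a * Z * a) + k * a * Z * (a * k) =
      (2 * k.det * a.det * Z.trace) • (1 : Mat2) := by
  rw [Matrix.trace_fin_two] at ha hk hka
  have ha' : a 1 1 = -a 0 0 := by linear_combination ha
  have hk' : k 1 1 = -k 0 0 := by linear_combination hk
  simp only [Matrix.mul_apply, Fin.sum_univ_two, ha', hk'] at hka
  ext i j
  fin_cases i <;> fin_cases j <;>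
    simp [Matrix.mul_apply, Fin.sum_univ_two, Matrix.det_fin_two, Matrix.trace_fin_two, ha', hk']
  all_goals grind

lemma trace_tracelessPart (A : Mat2) : (tracelessPart A).trace = 0 := by
  simp [tracelessPart, Matrix.trace_fin_two]

lemma trace_commutator (A B : Mat2) : (commutator A B).trace = 0 := by
  rw [commutator, Matrix.trace_sub, Matrix.trace_mul_comm, sub_self]

lemma trace_commutator_mul_tracelessPart (A B : Mat2) :
    (commutator A B * tracelessPart A).trace = 0 := by
  simp [commutator, tracelessPart, Matrix.trace_fin_two, Matrix.mul_apply, Fin.sum_univ_two]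
  ring

lemma tracelessPart_conj {X : Mat2} (hX : IsUnit X.det) (A : Mat2) :
    tracelessPart (X * A * X⁻¹) = X * tracelessPart A * X⁻¹ := by
  rw [tracelessPart, tracelessPart, Matrix.mul_sub, Matrix.sub_mul, Matrix.mul_smul, Matrix.mul_one,
    Matrix.smul_mul, Matrix.mul_nonsing_inv _ hX, Matrix.trace_mul_comm, ← Matrix.mul_assoc,
    Matrix.nonsing_inv_mul _ hX, Matrix.one_mul]

lemma commutator_conj {X : Mat2} (hX : IsUnit X.det) (A B : Mat2) :
    commutator (X * A * X⁻¹) (X * B * X⁻¹) = X * commutator A B * X⁻¹ := by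
  have h : ∀ C D : Mat2, X * C * X⁻¹ * (X * D * X⁻¹) = X * (C * D) * X⁻¹ := fun C D => by
    simp only [Matrix.mul_assoc, Matrix.nonsing_inv_mul_cancel_left _ _ hX]
  rw [commutator, commutator, h, h, Matrix.mul_sub, Matrix.sub_mul]

lemma intertwiner_conj {X : Mat2} (hX : IsUnit X.det) (A B : Mat2) :
    intertwiner A B (X * A * X⁻¹) (X * B * X⁻¹) =
      (2 * (commutator A B).det * (tracelessPart A).det * X⁻¹.trace) • X := by
  rw [intertwiner, tracelessPart_conj hX, commutator_conj hX]
  have h := congrArg (X * ·) (quaternion_average (trace_tracelessPart A) (trace_commutator A B)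
    (trace_commutator_mul_tracelessPart A B) X⁻¹)
  simp only [Matrix.mul_add, Matrix.mul_sub, Matrix.mul_smul, Matrix.mul_nonsing_inv _ hX,
    Matrix.mul_one, ← Matrix.mul_assoc] at h
  rw [← h]
  simp only [Matrix.mul_assoc, Matrix.nonsing_inv_mul_cancel_left _ _ hX]

lemma mul_self_eq_zero_of_trace_det {N : Mat2} (ht : N.trace = 0) (hd : N.det = 0) :
    N * N = 0 := by
  rw [Matrix.trace_fin_two] at ht
  rw [Matrix.det_fin_two] at hd
  ext i j
  fin_cases i <;> fin_cases j <;> simp [Matrix.mul_apply, Fin.sum_univ_two]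
  · linear_combination N 0 0 * ht - hd
  · linear_combination N 0 1 * ht
  · linear_combination N 1 0 * ht
  · linear_combination N 1 1 * ht - hd

/-- A normal nilpotent matrix is zero, so a unitary matrix with a double eigenvalue is scalar. -/
lemma det_tracelessPart_ne_zero {U V : Mat2} (hU : U ∈ Matrix.unitaryGroup (Fin 2) ℂ)
    (h : commutator U V ≠ 0) : (tracelessPart U).det ≠ 0 := by
  intro hd
  set N := tracelessPart U with hN
  have hNN := mul_self_eq_zero_of_trace_det (trace_tracelessPart U) hd
  have h1 : Uᴴ * U = 1 := Matrix.mem_unitaryGroup_iff'.1 hU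
  have h2 : U * Uᴴ = 1 := Matrix.mem_unitaryGroup_iff.1 hU
  have hnormal : Nᴴ * N = N * Nᴴ := by
    rw [hN, tracelessPart, Matrix.conjTranspose_sub, Matrix.conjTranspose_smul,
      Matrix.conjTranspose_one]
    simp only [Matrix.sub_mul, Matrix.mul_sub, h1, h2, Matrix.smul_mul, Matrix.mul_smul,
      Matrix.one_mul, Matrix.mul_one]
    module
  have h3 : (Nᴴ * N)ᴴ * (Nᴴ * N) = 0 := by
    rw [Matrix.conjTranspose_mul, Matrix.conjTranspose_conjTranspose]
    calc Nᴴ * N * (Nᴴ * N) = Nᴴ * (N * Nᴴ) * N := by simp only [Matrix.mul_assoc]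
      _ = Nᴴ * Nᴴ * (N * N) := by rw [← hnormal]; simp only [Matrix.mul_assoc]
      _ = 0 := by rw [hNN, Matrix.mul_zero]
  have h4 : N = 0 := Matrix.conjTranspose_mul_self_eq_zero.1
    (Matrix.conjTranspose_mul_self_eq_zero.1 h3)
  apply h
  have h5 : U = (U.trace / 2) • (1 : Mat2) := sub_eq_zero.1 h4
  rw [commutator, h5]
  simp

/-- The group commutator of two unitary matrices has determinant `1`; if it has the eigenvalue `1`,
then it is the identity. -/
lemma det_commutator_ne_zero {U V : Mat2} (hU : U ∈ Matrix.unitaryGroup (Fin 2) ℂ)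
    (hV : V ∈ Matrix.unitaryGroup (Fin 2) ℂ) (h : commutator U V ≠ 0) :
    (commutator U V).det ≠ 0 := by
  intro hd
  have u1 : Uᴴ * U = 1 := Matrix.mem_unitaryGroup_iff'.1 hU
  have u2 : U * Uᴴ = 1 := Matrix.mem_unitaryGroup_iff.1 hU
  have v1 : Vᴴ * V = 1 := Matrix.mem_unitaryGroup_iff'.1 hV
  have v2 : V * Vᴴ = 1 := Matrix.mem_unitaryGroup_iff.1 hV
  set W : Mat2 := U * V * (Uᴴ * Vᴴ) with hW
  have hWm : W ∈ Matrix.unitaryGroup (Fin 2) ℂ :=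
    mul_mem (mul_mem hU hV) (mul_mem (Unitary.star_mem hU) (Unitary.star_mem hV))
  have w1 : Wᴴ * W = 1 := Matrix.mem_unitaryGroup_iff'.1 hWm
  -- `U V - V U` is invertible together with `W - 1`, where `W = U V U⁻¹ V⁻¹`
  have hWc : commutator U V = (W - 1) * (V * U) := by
    rw [Matrix.sub_mul, Matrix.one_mul, hW, commutator]
    congr 1
    calc U * V = U * V * (Uᴴ * (Vᴴ * V) * U) := by rw [v1, Matrix.mul_one, u1, Matrix.mul_one]
      _ = _ := by simp only [Matrix.mul_assoc]
  have du : U.det * Uᴴ.det = 1 := by rw [← Matrix.det_mul, u2, Matrix.det_one]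
  have dv : V.det * Vᴴ.det = 1 := by rw [← Matrix.det_mul, v2, Matrix.det_one]
  have dW : W.det = 1 := by
    rw [hW, Matrix.det_mul, Matrix.det_mul, Matrix.det_mul]
    linear_combination V.det * Vᴴ.det * du + dv
  have hd1 : (W - 1).det = 0 := by
    rw [hWc, Matrix.det_mul, Matrix.det_mul] at hd
    exact (mul_eq_zero.1 hd).resolve_right
      (mul_ne_zero (left_ne_zero_of_mul_eq_one dv) (left_ne_zero_of_mul_eq_one du))
  -- the characteristic polynomial of `W` is `(x - 1)²`, and a unitary matrix with trace `2` is `1`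
  have htr : W.trace = 2 := by
    rw [Matrix.det_fin_two] at dW hd1
    simp at hd1
    rw [Matrix.trace_fin_two]
    linear_combination dW - hd1
  have h0 : ((W - 1)ᴴ * (W - 1)).trace = 0 := by
    rw [Matrix.conjTranspose_sub, Matrix.conjTranspose_one]
    simp only [Matrix.sub_mul, Matrix.mul_sub, w1, Matrix.one_mul, Matrix.mul_one,
      Matrix.trace_sub, Matrix.trace_conjTranspose, htr, Matrix.trace_one]
    simp
  rw [Matrix.trace_conjTranspose_mul_self_eq_zero_iff] at h0
  exact h (by rw [hWc, h0, Matrix.zero_mul])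

variable {ι : Type*}

/-- `Y` is the matrix of a positive definite Hermitian form that is invariant under every member of
the family. -/
def IsInvariantForm (A : ι → Mat2) (Y : Mat2) : Prop :=
  Y.PosDef ∧ ∀ k, (A k)ᴴ * Y * A k = Y

lemma posDef_conjTranspose_mul_self {P : Mat2} (hP : P.det ≠ 0) : (Pᴴ * P).PosDef :=
  Matrix.PosDef.conjTranspose_mul_self P
    (Matrix.mulVec_injective_of_isUnit
      ((Matrix.isUnit_iff_isUnit_det P).2 (isUnit_iff_ne_zero.2 hP)))

lemma mem_unitaryGroup_iff_invariant {P A : Mat2} (hP : P.det ≠ 0) :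
    P * A * P⁻¹ ∈ Matrix.unitaryGroup (Fin 2) ℂ ↔ Aᴴ * (Pᴴ * P) * A = Pᴴ * P := by
  have hPu : IsUnit P.det := isUnit_iff_ne_zero.2 hP
  have hPs : IsUnit Pᴴ.det := by
    rw [Matrix.det_conjTranspose]
    exact hPu.star
  rw [Matrix.mem_unitaryGroup_iff', Matrix.star_eq_conjTranspose]
  have e : (P * A * P⁻¹)ᴴ * (P * A * P⁻¹) = (Pᴴ)⁻¹ * (Aᴴ * (Pᴴ * P) * A) * P⁻¹ := by
    rw [← Matrix.conjTranspose_nonsing_inv]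
    simp only [Matrix.conjTranspose_mul, Matrix.mul_assoc]
  rw [e]
  constructor
  · intro h
    have h2 := congrArg (fun N => Pᴴ * N * P) h
    simp only [Matrix.mul_assoc, Matrix.nonsing_inv_mul _ hPu, Matrix.mul_one,
      Matrix.mul_nonsing_inv_cancel_left _ _ hPs] at h2
    simpa only [Matrix.mul_assoc, Matrix.one_mul] using h2
  · intro h
    rw [h, Matrix.nonsing_inv_mul_cancel_left _ _ hPs, Matrix.mul_nonsing_inv _ hPu]

lemma exists_invariantForm {A : ι → Mat2} (h : SimultaneouslyUnitarizable A) :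
    ∃ P : Mat2, P.det ≠ 0 ∧ (∀ k, P * A k * P⁻¹ ∈ Matrix.unitaryGroup (Fin 2) ℂ) ∧
      IsInvariantForm A (Pᴴ * P) := by
  obtain ⟨C, hC⟩ := h
  have hdet : (C : Mat2).det ≠ 0 := ((Matrix.isUnit_iff_isUnit_det _).1 C.isUnit).ne_zero
  have hC' : ∀ k, (C : Mat2) * A k * (C : Mat2)⁻¹ ∈ Matrix.unitaryGroup (Fin 2) ℂ := fun k => by
    rw [← Matrix.coe_units_inv]
    exact hC k
  exact ⟨C, hdet, hC', posDef_conjTranspose_mul_self hdet, fun k =>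
    (mem_unitaryGroup_iff_invariant hdet).1 (hC' k)⟩

/-- The form produced by `intertwiner` is a nonzero multiple of every invariant form `Y`, because
invariance means that `Y` conjugates `A k` to the inverse of its conjugate transpose. -/
lemma intertwiner_eq_smul {A : ι → Mat2} {Y : Mat2} (hY : IsInvariantForm A Y)
    (hA : ∀ k, (A k).det ≠ 0) {i j : ι} (hunit : SimultaneouslyUnitarizable A)
    (hc : commutator (A i) (A j) ≠ 0) :
    ∃ c : ℂ, c ≠ 0 ∧ intertwiner (A i) (A j) ((A i)ᴴ)⁻¹ ((A j)ᴴ)⁻¹ = c • Y := by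
  have hYu : IsUnit Y.det := (Matrix.isUnit_iff_isUnit_det _).1 hY.1.isUnit
  have hk : ∀ k, ((A k)ᴴ)⁻¹ = Y * A k * Y⁻¹ := fun k => by
    have hAu : IsUnit (A k)ᴴ.det := by
      rw [Matrix.det_conjTranspose]
      exact (isUnit_iff_ne_zero.2 (hA k)).star
    refine Matrix.inv_eq_right_inv ?_
    rw [← Matrix.mul_assoc, ← Matrix.mul_assoc, hY.2 k, Matrix.mul_nonsing_inv _ hYu]
  refine ⟨_, ?_, by rw [hk i, hk j, intertwiner_conj hYu]⟩
  obtain ⟨P, hP, hPu, -⟩ := exists_invariantForm hunit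
  have hPd : IsUnit P.det := isUnit_iff_ne_zero.2 hP
  have hcP : commutator (P * A i * P⁻¹) (P * A j * P⁻¹) ≠ 0 := by
    rw [commutator_conj hPd]
    intro h0
    have h1 := congrArg (fun N => P⁻¹ * N * P) h0
    simp only [Matrix.mul_assoc, Matrix.nonsing_inv_mul _ hPd, Matrix.mul_one,
      Matrix.nonsing_inv_mul_cancel_left _ _ hPd, Matrix.zero_mul, Matrix.mul_zero] at h1
    exact hc h1
  have hdetc : ∀ N : Mat2, (P * N * P⁻¹).det = N.det := fun N => by
    rw [Matrix.det_mul, Matrix.det_mul, Matrix.det_nonsing_inv, Ring.inverse_eq_inv']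
    field_simp
  have h1 := det_tracelessPart_ne_zero (hPu i) hcP
  have h2 := det_commutator_ne_zero (hPu i) (hPu j) hcP
  rw [tracelessPart_conj hPd, hdetc] at h1
  rw [commutator_conj hPd, hdetc] at h2
  exact mul_ne_zero (mul_ne_zero (mul_ne_zero two_ne_zero h2) h1) hY.1.inv.trace_pos.ne'

/-- The conjugate transpose reflected in the circle; on the circle it is the conjugate
transpose. -/
noncomputable def matReflect (F : ℂ → Mat2) (z : ℂ) : Mat2 := (F (conj z)⁻¹)ᴴ

lemma matReflect_apply {F : ℂ → Mat2} {z : ℂ} (hz : z ∈ unitCircle) :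
    matReflect F z = (F z)ᴴ := by
  rw [matReflect, conj_inv_of_mem_unitCircle hz]

lemma MatAnalytic.matReflect {F : ℂ → Mat2} (hF : MatAnalytic unitCircle F) :
    MatAnalytic unitCircle (matReflect F) := fun i j => analyticOnNhd_circleReflect (hF j i)

lemma MatAnalytic.inv {S : Set ℂ} {F : ℂ → Mat2} (hF : MatAnalytic S F)
    (h : ∀ z ∈ S, (F z).det ≠ 0) : MatAnalytic S fun z => (F z)⁻¹ := by
  simp only [Matrix.inv_def, Ring.inverse_eq_inv']
  exact MatAnalytic.smul (hF.det.inv h) hF.adjugate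

lemma MatAnalytic.intertwiner {S : Set ℂ} {A B A' B' : ℂ → Mat2} (hA : MatAnalytic S A)
    (hB : MatAnalytic S B) (hA' : MatAnalytic S A') (hB' : MatAnalytic S B') :
    MatAnalytic S fun z => intertwiner (A z) (B z) (A' z) (B' z) := by
  have hc : ∀ {F G : ℂ → Mat2}, MatAnalytic S F → MatAnalytic S G →
      MatAnalytic S fun z => commutator (F z) (G z) := fun hF hG => (hF.mul hG).sub (hG.mul hF)
  have ht : ∀ {F : ℂ → Mat2}, MatAnalytic S F → MatAnalytic S fun z => tracelessPart (F z) :=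
    fun hF => hF.sub (MatAnalytic.smul
      (hF.trace.div analyticOnNhd_const fun _ _ => two_ne_zero) (MatAnalytic.const 1))
  have k := hc hA hB
  have k' := hc hA' hB'
  have a := ht hA
  have a' := ht hA'
  exact (((MatAnalytic.smul (k.det.mul a.det) (MatAnalytic.const 1)).sub
    (MatAnalytic.smul a.det (k'.mul k))).sub (MatAnalytic.smul k.det (a'.mul a))).add
    ((k'.mul a').mul (a.mul k))

/-- There is an analytic positive semidefinite loop that is at almost every point of the circle the
invariant form, which is unique up to scaling. -/
theorem exists_invariant_loop {A : ι → ℂ → Mat2}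
    (hA : ∀ k, MatAnalytic unitCircle (A k))
    (hdet : ∀ k, ∀ z ∈ unitCircle, (A k z).det ≠ 0)
    (hnd : ∃ z ∈ unitCircle, Nondegenerate fun k => A k z)
    (hunit : {z ∈ unitCircle | ¬ SimultaneouslyUnitarizable fun k => A k z}.Finite) :
    ∃ (X : ℂ → Mat2) (T : Set ℂ), MatAnalytic unitCircle X ∧ T.Finite ∧
      (∀ z ∈ unitCircle, (X z).PosSemidef) ∧ ∀ z ∈ unitCircle \ T,
        IsInvariantForm (fun k => A k z) (X z) ∧
        ∀ Y, IsInvariantForm (fun k => A k z) Y → ∃ t : ℂ, 0 < t ∧ X z = t • Y := by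
  obtain ⟨z₀, hz₀, i, j, -, hij⟩ := hnd
  have hcom : MatAnalytic unitCircle fun z => commutator (A i z) (A j z) :=
    ((hA i).mul (hA j)).sub ((hA j).mul (hA i))
  obtain ⟨r, s, hrs⟩ : ∃ r s, commutator (A i z₀) (A j z₀) r s ≠ 0 := by
    by_contra! h0
    exact hij (Matrix.ext h0)
  have hfin := finite_zeros (hcom r s) ⟨z₀, hz₀, hrs⟩
  have hinv : ∀ k, MatAnalytic unitCircle fun z => (matReflect (A k) z)⁻¹ := fun k =>
    (hA k).matReflect.inv fun z hz => by
      rw [matReflect_apply hz, Matrix.det_conjTranspose]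
      exact star_ne_zero.2 (hdet k z hz)
  let X₁ : ℂ → Mat2 := fun z =>
    intertwiner (A i z) (A j z) (matReflect (A i) z)⁻¹ (matReflect (A j) z)⁻¹
  have hX₁ : MatAnalytic unitCircle X₁ := (hA i).intertwiner (hA j) (hinv i) (hinv j)
  -- `X₁` is a complex multiple of a positive definite matrix; multiplication with the conjugate of
  -- its trace makes the factor positive
  let X : ℂ → Mat2 := fun z => circleReflect (fun z => (X₁ z).trace) z • X₁ z
  have hX : MatAnalytic unitCircle X :=
    MatAnalytic.smul (analyticOnNhd_circleReflect hX₁.trace) hX₁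
  let T : Set ℂ := {z ∈ unitCircle | ¬ SimultaneouslyUnitarizable fun k => A k z} ∪
    {z ∈ unitCircle | commutator (A i z) (A j z) r s = 0}
  have hT : T.Finite := hunit.union hfin
  have key : ∀ z ∈ unitCircle \ T, SimultaneouslyUnitarizable (fun k => A k z) ∧
      ∀ Y, IsInvariantForm (fun k => A k z) Y → ∃ t : ℂ, 0 < t ∧ X z = t • Y := by
    rintro z ⟨hz, hzT⟩
    have hu : SimultaneouslyUnitarizable fun k => A k z := by
      by_contra h0
      exact hzT (Or.inl ⟨hz, h0⟩)
    have hc : commutator (A i z) (A j z) ≠ 0 := fun h0 =>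
      hzT (Or.inr ⟨hz, by rw [h0]; rfl⟩)
    refine ⟨hu, fun Y hY => ?_⟩
    obtain ⟨c, hc0, hcY⟩ := intertwiner_eq_smul hY (fun k => hdet k z hz) hu hc
    have hX₁z : X₁ z = c • Y := by
      simp only [X₁, matReflect_apply hz]
      exact hcY
    have htr := hY.1.trace_pos
    have htc : conj Y.trace = Y.trace := conj_eq_iff_im.2 (Complex.pos_iff.1 htr).2.symm
    have hcc : 0 < conj c * c := by
      rw [mul_comm, mul_conj]
      exact_mod_cast normSq_pos.2 hc0
    refine ⟨conj c * c * Y.trace, mul_pos hcc htr, ?_⟩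
    simp only [X, circleReflect_apply hz, hX₁z, Matrix.trace_smul, smul_eq_mul, map_mul, htc,
      smul_smul]
    congr 1
    ring
  have hinvX : ∀ z ∈ unitCircle \ T, IsInvariantForm (fun k => A k z) (X z) := by
    intro z hz
    obtain ⟨hu, h1⟩ := key z hz
    obtain ⟨P, -, -, hP⟩ := exists_invariantForm hu
    obtain ⟨t, ht, hXt⟩ := h1 _ hP
    rw [hXt]
    refine ⟨hP.1.smul ht, fun k => ?_⟩
    rw [Matrix.mul_smul, Matrix.smul_mul, hP.2 k]
  exact ⟨X, T, hX, hT, fun z hz => mem_of_finite_exception hX.continuousOn isClosed_posSemidef hT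
    (fun y hy => (hinvX y hy).1.posSemidef) hz, fun z hz => ⟨hinvX z hz, (key z hz).2⟩⟩

/-! ### Extension of the conjugated loops -/

lemma exists_ne_zero_on_circle {f : ℂ → ℂ} (hf : AnalyticOnNhd ℂ f closedDisk) (h0 : f 0 ≠ 0) :
    ∃ z ∈ unitCircle, f z ≠ 0 := by
  by_contra! h
  obtain ⟨c, hc⟩ := exists_eq_const_of_real hf fun z hz => by rw [h z hz, zero_im]
  have h1 := hc 1 (by simp)
  rw [h 1 (by simp)] at h1
  exact h0 (by rw [hc 0 (by simp), ← h1])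

lemma isClosed_unitaryGroup : IsClosed {A : Mat2 | A ∈ Matrix.unitaryGroup (Fin 2) ℂ} := by
  simp only [Matrix.mem_unitaryGroup_iff', Matrix.star_eq_conjTranspose]
  exact isClosed_eq (by fun_prop) continuous_const

/-- The entries of `C * A * C⁻¹` are quotients by `det C` that are bounded on the circle where they
are defined, as unitary matrices have bounded entries; hence they extend. -/
lemma conjugatesToUnitary_of_invariant {A : ι → ℂ → Mat2} (hA : ∀ k, MatAnalytic unitCircle (A k))
    {C : ℂ → Mat2} (hC : MatAnalytic unitCircle C) (hdet : ∃ z ∈ unitCircle, (C z).det ≠ 0)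
    {T : Set ℂ} (hT : T.Finite)
    (h : ∀ z ∈ unitCircle \ T, ∀ k, (A k z)ᴴ * ((C z)ᴴ * C z) * A k z = (C z)ᴴ * C z) :
    ConjugatesToUnitary A C := by
  intro k
  set Z : Set ℂ := {z ∈ unitCircle | (C z).det = 0} with hZ
  have hZfin : Z.Finite := finite_zeros hC.det hdet
  have hG : MatAnalytic unitCircle fun z => C z * A k z * (C z).adjugate :=
    (hC.mul (hA k)).mul hC.adjugate
  have hGe : ∀ z, (C z).det ≠ 0 →
      C z * A k z * (C z).adjugate = (C z).det • (C z * A k z * (C z)⁻¹) := fun z hz => by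
    rw [Matrix.inv_def, Ring.inverse_eq_inv', Matrix.mul_smul, smul_inv_smul₀ hz]
  have hU : ∀ z ∈ unitCircle \ (T ∪ Z),
      C z * A k z * (C z)⁻¹ ∈ Matrix.unitaryGroup (Fin 2) ℂ := fun z hz => by
    have hz0 : (C z).det ≠ 0 := fun h0 => hz.2 (Or.inr ⟨hz.1, h0⟩)
    exact (mem_unitaryGroup_iff_invariant hz0).2 (h z ⟨hz.1, fun h0 => hz.2 (Or.inl h0)⟩ k)
  have hB : ∀ i j, ∀ z ∈ unitCircle,
      ‖(C z * A k z * (C z).adjugate) i j‖ ≤ 1 * ‖(C z).det‖ := fun i j z hz => by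
    have h1 := mem_of_finite_exception
      (F := fun z => ‖(C z).det‖ - ‖(C z * A k z * (C z).adjugate) i j‖) (K := Ici 0)
      (hC.det.continuousOn.norm.sub (hG i j).continuousOn.norm) isClosed_Ici (hT.union hZfin)
      (fun y hy => by
        have hy0 : (C y).det ≠ 0 := fun h0 => hy.2 (Or.inr ⟨hy.1, h0⟩)
        rw [mem_Ici, sub_nonneg, hGe y hy0, Matrix.smul_apply, norm_smul]
        exact mul_le_of_le_one_right (norm_nonneg _) (entry_norm_bound_of_unitary (hU y hy) i j)) hz
    rw [mem_Ici, sub_nonneg] at h1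
    rwa [one_mul]
  choose q hq hqe using fun i j => exists_quotient_of_bounded le_rfl (hG i j) hC.det
    (fun z hz hz' => absurd hz hz') hdet (hB i j)
  let N : ℂ → Mat2 := fun z => Matrix.of fun i j => q i j z
  have hN : MatAnalytic unitCircle N := hq
  have hNe : ∀ z ∈ unitCircle, (C z).det ≠ 0 → N z = C z * A k z * (C z)⁻¹ := by
    intro z hz hz0
    ext i j
    have h1 : (C z * A k z * (C z).adjugate) i j = q i j z * (C z).det := hqe i j z hz
    rw [hGe z hz0, Matrix.smul_apply, smul_eq_mul, mul_comm] at h1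
    exact (mul_right_cancel₀ hz0 h1).symm
  refine ⟨N, ⟨fun i j => (hN i j).analyticOn, fun z hz => ?_⟩, hNe⟩
  refine mem_of_finite_exception hN.continuousOn isClosed_unitaryGroup (hT.union hZfin)
    (fun y hy => ?_) hz
  have hy0 : (C y).det ≠ 0 := fun h0 => hy.2 (Or.inr ⟨hy.1, h0⟩)
  have := hU y hy
  rwa [← hNe y hy.1 hy0] at this

/-! ### Normalization of the spectral factor -/

/-- Common zeros of all entries on the circle may be divided out; each of them lowers the degree of
the determinant by two. -/
lemma exists_primitive {Y : ℂ → Mat2} (hY : MatAnalytic closedDisk Y)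
    (hdet : ∀ z ∈ unitDisk, (Y z).det ≠ 0) :
    ∃ Y' : ℂ → Mat2, MatAnalytic closedDisk Y' ∧ (∀ z ∈ unitDisk, (Y' z).det ≠ 0) ∧
      (∀ z ∈ unitCircle, Y' z ≠ 0) ∧ ∃ T : Set ℂ, T.Finite ∧
        ∀ z ∈ unitCircle \ T, ∃ t : ℂ, t ≠ 0 ∧ Y z = t • Y' z := by
  obtain ⟨m, hm⟩ := exists_hasZeroDegree unitCircle_subset_closedDisk hY.det
    (fun z hz hzc => hdet z (by
      rw [mem_unitCircle] at hzc
      rw [mem_closedBall_zero_iff] at hz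
      exact mem_ball_zero_iff.2 (lt_of_le_of_ne hz hzc)))
    (exists_ne_zero_on_circle hY.det (hdet 0 (by simp)))
  induction m using Nat.strong_induction_on generalizing Y with
  | _ m ih =>
  by_cases hz : ∃ a ∈ unitCircle, Y a = 0
  swap
  · push Not at hz
    exact ⟨Y, hY, hdet, hz, ∅, finite_empty, fun z _ => ⟨1, one_ne_zero, (one_smul _ _).symm⟩⟩
  obtain ⟨a, ha, hYa⟩ := hz
  let Y₁ : ℂ → Mat2 := fun z => Matrix.of fun i j => dslope (fun z => Y z i j) a z
  have hY₁ : MatAnalytic closedDisk Y₁ := fun i j =>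
    analyticOnNhd_dslope (hY i j) (unitCircle_subset_closedDisk ha)
  have hYY₁ : ∀ z, Y z = (z - a) • Y₁ z := fun z => by
    ext i j
    exact sub_mul_dslope (f := fun z => Y z i j) (by rw [hYa]; rfl) z
  have hd : ∀ z, (Y z).det = (z - a) * ((z - a) * (Y₁ z).det) := fun z => by
    rw [hYY₁, Matrix.det_smul, Fintype.card_fin]
    ring
  obtain ⟨m₁, hm₁, hd₁⟩ := hm.of_eq_sub_mul unitCircle_subset_closedDisk ha
    ((analyticOnNhd_id.sub analyticOnNhd_const).mul hY₁.det) fun z _ => hd z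
  obtain ⟨m₂, hm₂, hd₂⟩ := hd₁.of_eq_sub_mul unitCircle_subset_closedDisk ha hY₁.det
    fun z _ => rfl
  obtain ⟨Y', hY', hdet', hne, T, hT, hYT⟩ := ih m₂ (by omega) hY₁
    (fun z hz h0 => hdet z hz (by rw [hd, h0, mul_zero, mul_zero])) hd₂
  refine ⟨Y', hY', hdet', hne, insert a T, hT.insert a, fun z hz => ?_⟩
  obtain ⟨t, ht, hYt⟩ := hYT z ⟨hz.1, fun h0 => hz.2 (Or.inr h0)⟩
  refine ⟨(z - a) * t, mul_ne_zero (sub_ne_zero.2 fun h0 => hz.2 (Or.inl h0)) ht, ?_⟩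
  rw [hYY₁, hYt, smul_smul]

/-- Gram–Schmidt for the columns of an invertible matrix. -/
lemma exists_unitary_mul_isPosUpperTriangular {Y : Mat2} (hY : Y.det ≠ 0) :
    ∃ U ∈ Matrix.unitaryGroup (Fin 2) ℂ, IsPosUpperTriangular (U * Y) := by
  set a := Y 0 0 with ha
  set c := Y 1 0 with hc
  have hpos : 0 < normSq a + normSq c := by
    refine lt_of_le_of_ne (add_nonneg (normSq_nonneg _) (normSq_nonneg _)) fun h0 => hY ?_
    have h1 : normSq a = 0 := by linarith [normSq_nonneg a, normSq_nonneg c]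
    have h2 : normSq c = 0 := by linarith [normSq_nonneg a, normSq_nonneg c]
    rw [Matrix.det_fin_two, ← ha, ← hc, normSq_eq_zero.1 h1, normSq_eq_zero.1 h2]
    ring
  set n : ℝ := Real.sqrt (normSq a + normSq c) with hn
  have hn0 : 0 < n := Real.sqrt_pos.2 hpos
  have hnc : (n : ℂ) ≠ 0 := ofReal_ne_zero.2 hn0.ne'
  have hnn : (n : ℂ) * n = conj a * a + conj c * c := by
    rw [← ofReal_mul, hn, Real.mul_self_sqrt hpos.le, ofReal_add, ← mul_conj, ← mul_conj]
    ring
  set d : ℝ := ‖Y.det‖ with hd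
  have hd0 : 0 < d := norm_pos_iff.2 hY
  have hdc : (d : ℂ) ≠ 0 := ofReal_ne_zero.2 hd0.ne'
  have hdd : Y.det * conj Y.det = d * d := by
    rw [mul_conj, normSq_eq_norm_sq, ← hd]
    push_cast
    ring
  set e : ℂ := conj Y.det / d with he
  have hee : e * conj e = 1 := by
    rw [he, map_div₀, Complex.conj_conj, conj_ofReal]
    field_simp
    linear_combination hdd
  have heD : e * Y.det = d := by
    rw [he]
    field_simp
    linear_combination hdd
  -- the phase `e` turns the second diagonal entry `det Y / n` of the product into `|det Y| / n`
  refine ⟨!![conj a / n, conj c / n; -(e * c) / n, e * a / n], ?_, ?_, fun i => ?_⟩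
  · rw [Matrix.mem_unitaryGroup_iff, Matrix.star_eq_conjTranspose]
    ext i j
    fin_cases i <;> fin_cases j <;>
      simp [Matrix.mul_apply, Fin.sum_univ_two, Matrix.conjTranspose_apply] <;> field_simp
    · linear_combination -hnn
    · ring
    · ring
    · linear_combination (a * conj a + c * conj c) * hee - hnn
  · rw [Matrix.mul_apply, Fin.sum_univ_two, ← ha, ← hc]
    simp only [Matrix.of_apply, Matrix.cons_val', Matrix.cons_val_zero, Matrix.cons_val_one]
    ring
  · rw [Matrix.det_fin_two, ← ha, ← hc] at heD
    fin_cases i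
    · have : (!![conj a / n, conj c / n; -(e * c) / n, e * a / n] * Y) 0 0 = n := by
        simp [Matrix.mul_apply, Fin.sum_univ_two, ← ha, ← hc]
        field_simp
        linear_combination -hnn
      simp [this, hn0]
    · have : (!![conj a / n, conj c / n; -(e * c) / n, e * a / n] * Y) 1 1 = (d / n : ℝ) := by
        simp [Matrix.mul_apply, Fin.sum_univ_two]
        field_simp
        linear_combination heD
      simp [this, -ofReal_div, div_pos hd0 hn0]

/-! ### Uniqueness -/

/-- A holomorphic function that is, on the circle, a bounded real multiple of a holomorphic function
without zeros in the disk is a constant real multiple of it. -/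
lemma exists_eq_const_mul {f d : ℂ → ℂ} (hf : AnalyticOnNhd ℂ f closedDisk)
    (hd : AnalyticOnNhd ℂ d closedDisk) (hd0 : ∀ z ∈ unitDisk, d z ≠ 0) {T : Set ℂ}
    (hT : T.Finite) {B : ℝ} (hB : ∀ z ∈ unitCircle \ T, ‖f z‖ ≤ B * ‖d z‖)
    (hreal : ∀ z ∈ unitCircle \ T, conj (f z) * d z = f z * conj (d z)) :
    ∃ c : ℝ, ∀ z ∈ closedDisk, f z = c * d z := by
  have hfc := hf.mono unitCircle_subset_closedDisk
  have hdc := hd.mono unitCircle_subset_closedDisk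
  have hne := exists_ne_zero_on_circle hd (hd0 0 (by simp))
  obtain ⟨q, hq, hqe⟩ := exists_quotient_of_bounded (B := B) unitCircle_subset_closedDisk hf hd
    (fun z hz hzc => hd0 z (by
      rw [mem_unitCircle] at hzc
      rw [mem_closedBall_zero_iff] at hz
      exact mem_ball_zero_iff.2 (lt_of_le_of_ne hz hzc))) hne fun z hz => by
    have h1 := mem_of_finite_exception (F := fun z => B * ‖d z‖ - ‖f z‖) (K := Ici 0)
      ((continuousOn_const.mul hdc.continuousOn.norm).sub hfc.continuousOn.norm) isClosed_Ici hT
      (fun y hy => sub_nonneg.2 (hB y hy)) hz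
    exact sub_nonneg.1 h1
  have hqc := hq.mono unitCircle_subset_closedDisk
  obtain ⟨c, hc⟩ := exists_eq_const_of_real hq fun z hz => by
    refine mem_of_finite_exception (F := fun z => (q z).im) (K := {0})
      (continuous_im.comp_continuousOn hqc.continuousOn) isClosed_singleton
      (hT.union (finite_zeros hdc hne)) (fun y hy => ?_) hz
    have hy0 : d y ≠ 0 := fun h0 => hy.2 (Or.inr ⟨hy.1, h0⟩)
    have h1 := hreal y ⟨hy.1, fun h0 => hy.2 (Or.inl h0)⟩
    rw [hqe y (unitCircle_subset_closedDisk hy.1), map_mul] at h1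
    refine conj_eq_iff_im.1 (mul_right_cancel₀ (mul_ne_zero hy0 (star_ne_zero.2 hy0)) ?_)
    rw [RCLike.star_def]
    linear_combination h1
  exact ⟨c, fun z hz => by rw [hqe z hz, hc z hz]⟩

/-- Relations between the entries of a multiple of a unitary matrix: up to the factor `ρ / det`, the
adjugate is the conjugate transpose. -/
lemma similitude_relations {a b c d ρ : ℂ}
    (h : (!![a, b; c, d] : Mat2)ᴴ * !![a, b; c, d] = ρ • (1 : Mat2)) :
    (conj a * (a * d - b * c) = ρ * d ∧ conj d * (a * d - b * c) = ρ * a ∧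
      conj c * (a * d - b * c) = -ρ * b) ∧
    conj (a * d - b * c) * (a * d - b * c) = ρ * ρ ∧ ‖a * d - b * c‖ = ‖ρ‖ ∧
    ‖a‖ ^ 2 ≤ ‖a * d - b * c‖ ∧ ‖d‖ ^ 2 ≤ ‖a * d - b * c‖ := by
  have e00 := congrFun (congrFun h 0) 0
  have e01 := congrFun (congrFun h 0) 1
  have e10 := congrFun (congrFun h 1) 0
  have e11 := congrFun (congrFun h 1) 1
  simp [Matrix.mul_apply, Fin.sum_univ_two, Matrix.conjTranspose_apply] at e00 e01 e10 e11
  have hD : conj (a * d - b * c) * (a * d - b * c) = ρ * ρ := by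
    simp only [map_sub, map_mul]
    linear_combination conj d * d * e00 + conj b * b * e00 - conj b * a * e01 - conj d * c * e01
      + ρ * e11
  have hDn : ‖a * d - b * c‖ = ‖ρ‖ := by
    have h1 := congrArg norm hD
    rw [norm_mul, norm_mul, RCLike.norm_conj] at h1
    exact (mul_self_inj (norm_nonneg _) (norm_nonneg _)).1 h1
  have hle : ∀ x y : ℂ, conj x * x + conj y * y = ρ → ‖x‖ ^ 2 ≤ ‖ρ‖ := fun x y hxy => by
    have h1 : ρ = ((‖x‖ ^ 2 + ‖y‖ ^ 2 : ℝ) : ℂ) := by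
      rw [← hxy, mul_comm, mul_conj, mul_comm, mul_conj, normSq_eq_norm_sq, normSq_eq_norm_sq]
      push_cast
      rfl
    rw [h1, norm_real, Real.norm_of_nonneg (by positivity)]
    linarith [sq_nonneg ‖y‖]
  refine ⟨⟨?_, ?_, ?_⟩, hD, hDn, ?_, ?_⟩
  · linear_combination d * e00 - c * e01
  · linear_combination a * e11 - b * e10
  · linear_combination a * e01 - b * e00
  · rw [hDn]
    exact hle a c e00
  · rw [hDn]
    exact hle d b (by linear_combination e11)

/-- Two holomorphic maps with proportional Hermitian squares on the circle are proportional in the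
disk. With `K = F₂ * adj F₁`, the loop `K` is on the circle a multiple of a unitary matrix. Hence
quadratic expressions in the entries of `K`, divided by `det K`, are bounded and occur in complex
conjugate pairs, so that they are constant, and the values at the origin show that `K` is scalar. -/
theorem exists_eq_smul_of_proportional {F₁ F₂ : ℂ → Mat2} (h₁ : MatAnalytic closedDisk F₁)
    (h₂ : MatAnalytic closedDisk F₂) (d₁ : ∀ z ∈ unitDisk, (F₁ z).det ≠ 0)
    (d₂ : ∀ z ∈ unitDisk, (F₂ z).det ≠ 0) (p₁ : IsPosUpperTriangular (F₁ 0))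
    (p₂ : IsPosUpperTriangular (F₂ 0)) {T : Set ℂ} (hT : T.Finite)
    (h : ∀ z ∈ unitCircle \ T, ∃ t : ℂ, (F₂ z)ᴴ * F₂ z = t • ((F₁ z)ᴴ * F₁ z)) :
    ∃ g : ℂ → ℂ, DifferentiableOn ℂ g unitDisk ∧ (∀ z ∈ unitDisk, g z ≠ 0) ∧
      ∀ z ∈ unitDisk, F₂ z = g z • F₁ z := by
  let K : ℂ → Mat2 := fun z => F₂ z * (F₁ z).adjugate
  have hK : MatAnalytic closedDisk K := h₂.mul h₁.adjugate
  let a : ℂ → ℂ := fun z => K z 0 0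
  let b : ℂ → ℂ := fun z => K z 0 1
  let c : ℂ → ℂ := fun z => K z 1 0
  let d : ℂ → ℂ := fun z => K z 1 1
  have ha : AnalyticOnNhd ℂ a closedDisk := hK 0 0
  have hb : AnalyticOnNhd ℂ b closedDisk := hK 0 1
  have hc : AnalyticOnNhd ℂ c closedDisk := hK 1 0
  have hd : AnalyticOnNhd ℂ d closedDisk := hK 1 1
  let D : ℂ → ℂ := fun z => a z * d z - b z * c z
  have hD : AnalyticOnNhd ℂ D closedDisk := (ha.mul hd).sub (hb.mul hc)
  have hKe : ∀ z, K z = !![a z, b z; c z, d z] := fun z => (Matrix.eta_fin_two (K z))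
  have hDdet : ∀ z, D z = (F₂ z).det * (F₁ z).det := fun z => by
    have : D z = (K z).det := by rw [Matrix.det_fin_two]
    rw [this, Matrix.det_mul, Matrix.det_adjugate]
    simp
  have hD0 : ∀ z ∈ unitDisk, D z ≠ 0 := fun z hz => by
    rw [hDdet]; exact mul_ne_zero (d₂ z hz) (d₁ z hz)
  have hsim : ∀ z ∈ unitCircle \ T, ∃ ρ : ℂ, (K z)ᴴ * K z = ρ • (1 : Mat2) := by
    intro z hz
    obtain ⟨t, ht⟩ := h z hz
    refine ⟨t * (conj (F₁ z).det * (F₁ z).det), ?_⟩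
    calc (K z)ᴴ * K z = (F₁ z).adjugateᴴ * ((F₂ z)ᴴ * F₂ z) * (F₁ z).adjugate := by
          simp only [K, Matrix.conjTranspose_mul, Matrix.mul_assoc]
      _ = t • ((F₁ z * (F₁ z).adjugate)ᴴ * (F₁ z * (F₁ z).adjugate)) := by
          rw [ht]
          simp only [Matrix.conjTranspose_mul, Matrix.mul_assoc, Matrix.mul_smul, Matrix.smul_mul]
      _ = _ := by
          rw [Matrix.mul_adjugate, Matrix.conjTranspose_smul, Matrix.conjTranspose_one,
            Matrix.smul_mul, Matrix.one_mul, smul_smul, smul_smul, mul_assoc]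
          rfl
  have hrel : ∀ z ∈ unitCircle \ T, ∃ ρ : ℂ, (conj (a z) * D z = ρ * d z ∧
      conj (d z) * D z = ρ * a z ∧ conj (c z) * D z = -ρ * b z) ∧
      conj (D z) * D z = ρ * ρ ∧ ‖D z‖ = ‖ρ‖ ∧ ‖a z‖ ^ 2 ≤ ‖D z‖ ∧ ‖d z‖ ^ 2 ≤ ‖D z‖ := by
    intro z hz
    obtain ⟨ρ, hρ⟩ := hsim z hz
    rw [hKe] at hρ
    exact ⟨ρ, similitude_relations hρ⟩
  have hDne := exists_ne_zero_on_circle hD (hD0 0 (by simp))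
  set Z : Set ℂ := {z ∈ unitCircle | D z = 0} with hZ
  have hTZ : (T ∪ Z).Finite := hT.union
    (finite_zeros (hD.mono unitCircle_subset_closedDisk) hDne)
  have hrel' : ∀ z ∈ unitCircle \ (T ∪ Z), D z ≠ 0 ∧ ∃ ρ : ℂ, (conj (a z) * D z = ρ * d z ∧
      conj (d z) * D z = ρ * a z ∧ conj (c z) * D z = -ρ * b z) ∧
      conj (D z) * D z = ρ * ρ ∧ ‖D z‖ = ‖ρ‖ ∧ ‖a z‖ ^ 2 ≤ ‖D z‖ ∧ ‖d z‖ ^ 2 ≤ ‖D z‖ :=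
    fun z hz => ⟨fun h0 => hz.2 (Or.inr ⟨hz.1, h0⟩),
      hrel z ⟨hz.1, fun h0 => hz.2 (Or.inl h0)⟩⟩
  -- the three quotients `a d / D`, `(a² + d²) / D`, `i (a² - d²) / D` are real on the circle
  obtain ⟨c₁, hc₁⟩ := exists_eq_const_mul (f := fun z => a z * d z) (ha.mul hd) hD hD0 hTZ (B := 1)
    (fun z hz => by
      obtain ⟨-, ρ, -, -, -, h3, h4⟩ := hrel' z hz
      rw [norm_mul]
      nlinarith [sq_nonneg (‖a z‖ - ‖d z‖)])
    (fun z hz => by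
      obtain ⟨h0, ρ, ⟨r1, r2, -⟩, r3, -⟩ := hrel' z hz
      refine mul_right_cancel₀ h0 ?_
      rw [map_mul]
      linear_combination conj (d z) * D z * r1 + ρ * d z * r2 - a z * d z * r3)
  obtain ⟨c₂, hc₂⟩ := exists_eq_const_mul (f := fun z => a z ^ 2 + d z ^ 2)
    ((ha.pow 2).add (hd.pow 2)) hD hD0 hTZ (B := 2)
    (fun z hz => by
      obtain ⟨-, ρ, -, -, -, h3, h4⟩ := hrel' z hz
      refine (norm_add_le _ _).trans ?_
      rw [norm_pow, norm_pow]
      linarith)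
    (fun z hz => by
      obtain ⟨h0, ρ, ⟨r1, r2, -⟩, r3, -⟩ := hrel' z hz
      refine mul_right_cancel₀ h0 ?_
      rw [map_add, map_pow, map_pow]
      linear_combination (conj (a z) * D z + ρ * d z) * r1 + (conj (d z) * D z + ρ * a z) * r2
        - (a z ^ 2 + d z ^ 2) * r3)
  obtain ⟨c₃, hc₃⟩ := exists_eq_const_mul (f := fun z => I * (a z ^ 2 - d z ^ 2))
    (analyticOnNhd_const.mul ((ha.pow 2).sub (hd.pow 2))) hD hD0 hTZ (B := 2)
    (fun z hz => by
      obtain ⟨-, ρ, -, -, -, h3, h4⟩ := hrel' z hz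
      rw [norm_mul, norm_I, one_mul]
      refine (norm_sub_le _ _).trans ?_
      rw [norm_pow, norm_pow]
      linarith)
    (fun z hz => by
      obtain ⟨h0, ρ, ⟨r1, r2, -⟩, r3, -⟩ := hrel' z hz
      refine mul_right_cancel₀ h0 ?_
      rw [map_mul, map_sub, map_pow, map_pow, conj_I]
      linear_combination -I * (conj (a z) * D z + ρ * d z) * r1
        + I * (conj (d z) * D z + ρ * a z) * r2 - I * (a z ^ 2 - d z ^ 2) * r3)
  have h0D : (0 : ℂ) ∈ closedDisk := by simp
  obtain ⟨t₁, q₁⟩ := p₁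
  obtain ⟨t₂, q₂⟩ := p₂
  have hval : ∀ {F : Mat2} {i : Fin 2}, 0 < (F i i).re ∧ (F i i).im = 0 →
      ∃ x : ℝ, 0 < x ∧ F i i = x := fun {F i} hF =>
    ⟨(F i i).re, hF.1, Complex.ext rfl (by simp [hF.2])⟩
  obtain ⟨x₁, hx₁, ex₁⟩ := hval (q₁ 0)
  obtain ⟨y₁, hy₁, ey₁⟩ := hval (q₁ 1)
  obtain ⟨x₂, hx₂, ex₂⟩ := hval (q₂ 0)
  obtain ⟨y₂, hy₂, ey₂⟩ := hval (q₂ 1)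
  have ha0 : a 0 = (x₂ * y₁ : ℝ) := by
    simp [a, K, Matrix.mul_apply, Fin.sum_univ_two, Matrix.adjugate_fin_two, ex₂, ey₁, t₁]
  have hd0 : d 0 = (y₂ * x₁ : ℝ) := by
    simp [d, K, Matrix.mul_apply, Fin.sum_univ_two, Matrix.adjugate_fin_two, ey₂, ex₁, t₂]
  have hc0 : c 0 = 0 := by
    simp [c, K, Matrix.mul_apply, Fin.sum_univ_two, Matrix.adjugate_fin_two, t₁, t₂]
  have hDat0 : D 0 = a 0 * d 0 := by simp only [D, hc0, mul_zero, sub_zero]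
  have hD00 := hD0 0 (by simp)
  have hc₁' : (c₁ : ℂ) = 1 := by
    have h1 := hc₁ 0 h0D
    simp only [← hDat0] at h1
    exact mul_right_cancel₀ hD00 (by rw [← h1, one_mul])
  -- at the origin `i (a² - d²)` is imaginary and a real multiple of the positive number `D`
  have had0 : a 0 = d 0 := by
    have h1 : I * (((x₂ * y₁) ^ 2 - (y₂ * x₁) ^ 2 : ℝ) : ℂ)
        = ((c₃ * (x₂ * y₁ * (y₂ * x₁)) : ℝ) : ℂ) := by
      have h2 := hc₃ 0 h0D
      simp only [hDat0, ha0, hd0] at h2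
      push_cast at h2 ⊢
      exact h2
    have him : (x₂ * y₁) ^ 2 - (y₂ * x₁) ^ 2 = 0 := by
      have h2 := congrArg im h1
      rwa [I_mul_im, ofReal_re, ofReal_im] at h2
    have h3 : x₂ * y₁ = y₂ * x₁ :=
      (sq_eq_sq₀ (by positivity) (by positivity)).1 (by linarith)
    rw [ha0, hd0, h3]
  have hc₂' : (c₂ : ℂ) = 2 := by
    have h1 := hc₂ 0 h0D
    refine mul_right_cancel₀ hD00 ?_
    rw [← h1, hDat0, had0]
    ring
  -- so `a d = D`, i.e. `b c = 0`, while `|b| = |c|` on the circle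
  have hbc : ∀ z ∈ closedDisk, b z * c z = 0 := fun z hz => by
    have h1 := hc₁ z hz
    rw [hc₁', one_mul] at h1
    have h2 : D z = a z * d z - b z * c z := rfl
    linear_combination h1 + h2
  have hbcT : ∀ z ∈ unitCircle \ (T ∪ Z), b z = 0 ∧ c z = 0 := fun z hz => by
    obtain ⟨h0, ρ, ⟨-, -, r⟩, -, hn, -⟩ := hrel' z hz
    have h1 := congrArg norm r
    rw [norm_mul, norm_mul, norm_neg, RCLike.norm_conj, ← hn, mul_comm] at h1
    have h2 : ‖c z‖ = ‖b z‖ := mul_left_cancel₀ (norm_ne_zero_iff.2 h0) h1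
    rcases mul_eq_zero.1 (hbc z (unitCircle_subset_closedDisk hz.1)) with h3 | h3
    · refine ⟨h3, norm_eq_zero.1 ?_⟩
      rw [h2, h3, norm_zero]
    · refine ⟨norm_eq_zero.1 ?_, h3⟩
      rw [← h2, h3, norm_zero]
  have hzero : ∀ f : ℂ → ℂ, AnalyticOnNhd ℂ f closedDisk →
      (∀ z ∈ unitCircle \ (T ∪ Z), f z = 0) → ∀ z ∈ closedDisk, f z = 0 := by
    intro f hf hfT
    have h1 : ∀ z ∈ unitCircle, f z = 0 := fun z hz =>
      eqOn_of_finite_exception (hf.mono unitCircle_subset_closedDisk).continuousOn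
        (continuousOn_const (c := (0 : ℂ))) hTZ hfT hz
    obtain ⟨e, he⟩ := exists_eq_const_of_real hf fun z hz => by rw [h1 z hz, zero_im]
    intro z hz
    rw [he z hz, ← he 1 (by simp), h1 1 (by simp)]
  have hb0 := hzero b hb fun z hz => (hbcT z hz).1
  have hc0 := hzero c hc fun z hz => (hbcT z hz).2
  have had : ∀ z ∈ closedDisk, a z = d z := fun z hz => by
    have h1 := hc₂ z hz
    have h2 := hc₁ z hz
    rw [hc₂'] at h1
    rw [hc₁', one_mul] at h2
    have h3 : (a z - d z) ^ 2 = 0 := by linear_combination h1 - 2 * h2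
    exact sub_eq_zero.1 (pow_eq_zero_iff two_ne_zero |>.1 h3)
  have hball : ∀ z ∈ unitDisk, z ∈ closedDisk := fun z hz => ball_subset_closedBall hz
  refine ⟨fun z => a z / (F₁ z).det, fun z hz => ?_, fun z hz => ?_, fun z hz => ?_⟩
  · exact ((ha z (hball z hz)).div (h₁.det z (hball z hz))
      (d₁ z hz)).differentiableAt.differentiableWithinAt
  · refine div_ne_zero (fun h0 => hD0 z hz ?_) (d₁ z hz)
    have h2 := hc₁ z (hball z hz)
    rw [hc₁', one_mul] at h2
    rw [← h2, h0, zero_mul]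
  · have h2 : K z = a z • (1 : Mat2) := by
      rw [hKe, hb0 z (hball z hz), hc0 z (hball z hz), ← had z (hball z hz)]
      ext i j
      fin_cases i <;> fin_cases j <;> simp
    have h3 : K z * F₁ z = (F₁ z).det • F₂ z := by
      simp only [K]
      rw [Matrix.mul_assoc, Matrix.adjugate_mul, Matrix.mul_smul, Matrix.mul_one]
    rw [h2, Matrix.smul_mul, Matrix.one_mul] at h3
    change F₂ z = (a z / (F₁ z).det) • F₁ z
    rw [div_eq_inv_mul, ← smul_smul, h3, smul_smul, inv_mul_cancel₀ (d₁ z hz), one_smul]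

/-- The scalar quotient of two proportional maps, the first of which has no common zeros of its
entries, is analytic along the circle and continuous on the closed disk. -/
lemma exists_scalarFactor {C F : ℂ → Mat2} (hC : MatAnalytic closedDisk C)
    (hF : MatAnalytic closedDisk F) (dC : ∀ z ∈ unitDisk, (C z).det ≠ 0)
    (dF : ∀ z ∈ unitDisk, (F z).det ≠ 0) (hC0 : ∀ z ∈ unitCircle, C z ≠ 0) {g : ℂ → ℂ}
    (hg : ∀ z ∈ unitDisk, F z = g z • C z) :
    ∃ f : ℂ → ℂ, IsScalarFactor f ∧ ∀ z ∈ unitCircle, F z = f z • C z := by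
  have hcl : closure unitDisk = closedDisk := closure_ball 0 one_ne_zero
  have hminor : ∀ i j k l, ∀ z ∈ closedDisk, F z k l * C z i j = F z i j * C z k l := by
    intro i j k l
    refine EqOn.of_subset_closure (s := unitDisk) (f := fun z => F z k l * C z i j)
      (g := fun z => F z i j * C z k l) (fun z hz => ?_)
      ((hF k l).continuousOn.mul (hC i j).continuousOn)
      ((hF i j).continuousOn.mul (hC k l).continuousOn) ball_subset_closedBall hcl.ge
    simp only [hg z hz, Matrix.smul_apply, smul_eq_mul]
    ring
  have hCne : ∀ z ∈ closedDisk, ∃ e : Fin 2 × Fin 2, C z e.1 e.2 ≠ 0 := by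
    intro z hz
    have h1 : C z ≠ 0 := by
      by_cases hzc : z ∈ unitCircle
      · exact hC0 z hzc
      · intro h0
        rw [mem_unitCircle] at hzc
        rw [mem_closedBall_zero_iff] at hz
        refine dC z (mem_ball_zero_iff.2 (lt_of_le_of_ne hz hzc)) ?_
        rw [h0, Matrix.det_zero]
    by_contra! h0
    exact h1 (Matrix.ext fun i j => h0 (i, j))
  choose! e he using hCne
  -- at every point the quotient is formed with an entry of `C` that does not vanish there
  let f : ℂ → ℂ := fun z => F z (e z).1 (e z).2 / C z (e z).1 (e z).2
  have hf : ∀ z ∈ closedDisk, F z = f z • C z := fun z hz => by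
    ext k l
    have h1 := hminor (e z).1 (e z).2 k l z hz
    have h2 := he z hz
    simp only [f, Matrix.smul_apply, smul_eq_mul]
    field_simp
    exact h1
  have hloc : ∀ z ∈ closedDisk, ∃ q : ℂ → ℂ, AnalyticAt ℂ q z ∧ f =ᶠ[𝓝[closedDisk] z] q ∧
      f z = q z := by
    intro z hz
    have h1 := he z hz
    have h2 : ∀ᶠ y in 𝓝 z, C y (e z).1 (e z).2 ≠ 0 :=
      (hC (e z).1 (e z).2 z hz).continuousAt.eventually_ne h1
    refine ⟨fun y => F y (e z).1 (e z).2 / C y (e z).1 (e z).2,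
      (hF _ _ z hz).div (hC _ _ z hz) h1, ?_, rfl⟩
    filter_upwards [nhdsWithin_le_nhds h2, self_mem_nhdsWithin] with y hy hyD
    rw [hf y hyD, Matrix.smul_apply, smul_eq_mul, mul_div_cancel_right₀ _ hy]
  have hfc : ContinuousOn f closedDisk := fun z hz => by
    obtain ⟨q, hq, hfq, hfz⟩ := hloc z hz
    exact hq.continuousAt.continuousWithinAt.congr_of_eventuallyEq hfq hfz
  refine ⟨f, ⟨fun z hz => ?_, f, ⟨fun z hz => ?_, hcl ▸ hfc⟩, fun z hz h0 => dF z hz ?_,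
    fun _ _ => rfl⟩, fun z hz => hf z (unitCircle_subset_closedDisk hz)⟩
  · obtain ⟨q, hq, hfq, hfz⟩ := hloc z (unitCircle_subset_closedDisk hz)
    refine hq.analyticWithinAt.congr_of_eventuallyEq
      (hfq.filter_mono (nhdsWithin_mono _ unitCircle_subset_closedDisk)) hfz
  · have hzD : z ∈ closedDisk := ball_subset_closedBall hz
    obtain ⟨q, hq, hfq, hfz⟩ := hloc z hzD
    refine (hq.differentiableAt.differentiableWithinAt).congr_of_eventuallyEq
      (hfq.filter_mono (nhdsWithin_mono _ ball_subset_closedBall)) hfz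
  · rw [hf z (ball_subset_closedBall hz), h0, zero_smul, Matrix.det_zero]

/-! ### Gluings -/

lemma IsAnalyticLoop.exists_matAnalytic {X : ℂ → Mat2} (hX : IsAnalyticLoop X) :
    ∃ E : ℂ → Mat2, MatAnalytic unitCircle E ∧ EqOn E X unitCircle := by
  choose E hE hEX using fun i j => exists_analyticOnNhd_extension (hX i j)
  exact ⟨fun z => Matrix.of fun i j => E i j z, hE, fun z hz => Matrix.ext fun i j => hEX i j hz⟩

lemma IsBoundaryOf.exists_matAnalytic {C F : ℂ → Mat2} (hC : IsAnalyticLoop C)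
    (hF : IsBoundaryOf C F) :
    ∃ G : ℂ → Mat2, MatAnalytic closedDisk G ∧ EqOn G F closedDisk := by
  obtain ⟨E, hE, hEC⟩ := hC.exists_matAnalytic
  choose G hG hGF using fun i j => exists_analyticOnNhd_closedDisk (hF.diffContOnCl i j) (hE i j)
    fun z hz => by rw [hF.boundary hz, hEC hz]
  exact ⟨fun z => Matrix.of fun i j => G i j z, hG, fun z hz => Matrix.ext fun i j => hGF i j hz⟩

/-- A gluing together with its holomorphic extension defines at almost every point of the circle an
invariant form. -/
lemma IsGluing.exists_extension {A : ι → ℂ → Mat2} {C F : ℂ → Mat2} (hC : IsGluing A C)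
    (hF : IsBoundaryOf C F) :
    ∃ G : ℂ → Mat2, MatAnalytic closedDisk G ∧ EqOn G F closedDisk ∧
      ∃ T : Set ℂ, T.Finite ∧
        ∀ z ∈ unitCircle \ T, IsInvariantForm (fun k => A k z) ((G z)ᴴ * G z) := by
  obtain ⟨G, hG, hGF⟩ := hF.exists_matAnalytic hC.1.1
  have hdet0 : (G 0).det ≠ 0 := by
    rw [hGF (by simp)]
    exact hF.det_ne_zero 0 (by simp)
  refine ⟨G, hG, hGF, _, finite_zeros (hG.mono unitCircle_subset_closedDisk).det
    (exists_ne_zero_on_circle hG.det hdet0), fun z hz => ?_⟩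
  have hz0 : (G z).det ≠ 0 := fun h0 => hz.2 ⟨hz.1, h0⟩
  have hGC : G z = C z := (hGF (unitCircle_subset_closedDisk hz.1)).trans (hF.boundary hz.1)
  refine ⟨posDef_conjTranspose_mul_self hz0, fun k => ?_⟩
  obtain ⟨N, hN, hNC⟩ := hC.2 k
  refine (mem_unitaryGroup_iff_invariant hz0).1 ?_
  rw [hGC] at hz0 ⊢
  rw [← hNC z hz.1 hz0]
  exact hN.2 z hz.1

/-- Existence and uniqueness of gluings for a family that is holomorphic near the circle. The gluing
of which all others are multiples is the primitive one, whose entries have no common zeros on the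
circle. -/
theorem gluing_theorem {A : ι → ℂ → Mat2} (hA : ∀ k, MatAnalytic unitCircle (A k))
    (hdet : ∀ k, ∀ z ∈ unitCircle, (A k z).det ≠ 0)
    (hnd : ∃ z ∈ unitCircle, Nondegenerate fun k => A k z)
    (hunit : {z ∈ unitCircle | ¬ SimultaneouslyUnitarizable fun k => A k z}.Finite) :
    (∃ C, IsGluing A C ∧ ∀ C', IsGluing A C' →
        ∃ f, IsScalarFactor f ∧ ∀ z ∈ unitCircle, C' z = f z • C z) ∧
    ∀ C₁ C₂ F₁ F₂, IsGluing A C₁ → IsGluing A C₂ → IsBoundaryOf C₁ F₁ → IsBoundaryOf C₂ F₂ →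
      ∃ g : ℂ → ℂ, DifferentiableOn ℂ g unitDisk ∧ (∀ z ∈ unitDisk, g z ≠ 0) ∧
        ∀ z ∈ unitDisk, F₂ z = g z • F₁ z := by
  obtain ⟨X, T, hX, hT, hXpos, hXT⟩ := exists_invariant_loop hA hdet hnd hunit
  have uniq : ∀ C₁ C₂ F₁ F₂, IsGluing A C₁ → IsGluing A C₂ → IsBoundaryOf C₁ F₁ →
      IsBoundaryOf C₂ F₂ → ∃ g : ℂ → ℂ, DifferentiableOn ℂ g unitDisk ∧
        (∀ z ∈ unitDisk, g z ≠ 0) ∧ ∀ z ∈ unitDisk, F₂ z = g z • F₁ z := by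
    intro C₁ C₂ F₁ F₂ hC₁ hC₂ hF₁ hF₂
    obtain ⟨G₁, hG₁, hGF₁, T₁, hT₁, hI₁⟩ := hC₁.exists_extension hF₁
    obtain ⟨G₂, hG₂, hGF₂, T₂, hT₂, hI₂⟩ := hC₂.exists_extension hF₂
    have e₁ : ∀ z ∈ unitDisk, G₁ z = F₁ z := fun z hz => hGF₁ (ball_subset_closedBall hz)
    have e₂ : ∀ z ∈ unitDisk, G₂ z = F₂ z := fun z hz => hGF₂ (ball_subset_closedBall hz)
    obtain ⟨g, hg, hg0, hgF⟩ := exists_eq_smul_of_proportional hG₁ hG₂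
      (fun z hz => by rw [e₁ z hz]; exact hF₁.det_ne_zero z hz)
      (fun z hz => by rw [e₂ z hz]; exact hF₂.det_ne_zero z hz)
      (by rw [e₁ 0 (by simp)]; exact hF₁.pos) (by rw [e₂ 0 (by simp)]; exact hF₂.pos)
      (hT.union (hT₁.union hT₂)) fun z hz => by
        have hzT : z ∈ unitCircle \ T := ⟨hz.1, fun h0 => hz.2 (Or.inl h0)⟩
        obtain ⟨t₁, ht₁, hX₁⟩ := (hXT z hzT).2 _
          (hI₁ z ⟨hz.1, fun h0 => hz.2 (Or.inr (Or.inl h0))⟩)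
        obtain ⟨t₂, ht₂, hX₂⟩ := (hXT z hzT).2 _
          (hI₂ z ⟨hz.1, fun h0 => hz.2 (Or.inr (Or.inr h0))⟩)
        refine ⟨t₂⁻¹ * t₁, ?_⟩
        rw [← smul_smul, ← hX₁, hX₂, smul_smul, inv_mul_cancel₀ ht₂.ne', one_smul]
    exact ⟨g, hg, hg0, fun z hz => by rw [← e₁ z hz, ← e₂ z hz]; exact hgF z hz⟩
  refine ⟨?_, uniq⟩
  obtain ⟨z₀, hz₀⟩ := exists_mem_unitCircle_diff hT
  obtain ⟨Y, hY, hY0, hYX⟩ := exists_factor_of_posSemidef hX hXpos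
    ⟨z₀, hz₀.1, (hXT z₀ hz₀).1.1.det_pos.ne'⟩
  obtain ⟨P, hP, hP0, hPne, S, hS, hYP⟩ := exists_primitive hY hY0
  obtain ⟨U, hU, hUP⟩ := exists_unitary_mul_isPosUpperTriangular (hP0 0 (by simp))
  have hUU : Uᴴ * U = 1 := Matrix.mem_unitaryGroup_iff'.1 hU
  have hUdet : U.det ≠ 0 := fun h0 => by
    have := congrArg Matrix.det hUU
    rw [Matrix.det_mul, h0, mul_zero, Matrix.det_one] at this
    exact zero_ne_one this
  let C : ℂ → Mat2 := fun z => U * P z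
  have hC : MatAnalytic closedDisk C := (MatAnalytic.const U).mul hP
  have hCdet : ∀ z ∈ unitDisk, (C z).det ≠ 0 := fun z hz => by
    rw [Matrix.det_mul]; exact mul_ne_zero hUdet (hP0 z hz)
  have hCC : ∀ z, (C z)ᴴ * C z = (P z)ᴴ * P z := fun z => by
    simp only [C, Matrix.conjTranspose_mul]
    rw [Matrix.mul_assoc, ← Matrix.mul_assoc Uᴴ, hUU, Matrix.one_mul]
  have hCne : ∀ z ∈ unitCircle, C z ≠ 0 := fun z hz h0 => hPne z hz (by
    have := congrArg (Uᴴ * ·) h0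
    simpa only [C, ← Matrix.mul_assoc, hUU, Matrix.one_mul, Matrix.mul_zero] using this)
  have hcl : closure unitDisk = closedDisk := closure_ball 0 one_ne_zero
  have hCb : IsBoundaryOf C C :=
    ⟨fun i j => ⟨fun z hz =>
      (hC i j z (ball_subset_closedBall hz)).differentiableAt.differentiableWithinAt,
      hcl ▸ (hC i j).continuousOn⟩, hCdet, hUP, fun _ _ => rfl⟩
  have hCinv : ∀ z ∈ unitCircle \ (T ∪ S), ∀ k,
      (A k z)ᴴ * ((C z)ᴴ * C z) * A k z = (C z)ᴴ * C z := by
    intro z hz k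
    obtain ⟨t, ht, hYt⟩ := hYP z ⟨hz.1, fun h0 => hz.2 (Or.inr h0)⟩
    have h1 := (hXT z ⟨hz.1, fun h0 => hz.2 (Or.inl h0)⟩).1.2 k
    have h2 : X z = (conj t * t) • ((C z)ᴴ * C z) := by
      rw [← hYX z hz.1, hYt, hCC, Matrix.conjTranspose_smul, Matrix.smul_mul, Matrix.mul_smul,
        smul_smul]
      rfl
    have ht2 : conj t * t ≠ 0 := mul_ne_zero (star_ne_zero.2 ht) ht
    rw [h2, Matrix.mul_smul, Matrix.smul_mul] at h1
    exact smul_right_injective _ ht2 h1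
  have hCc : MatAnalytic unitCircle C := hC.mono unitCircle_subset_closedDisk
  have hCg : IsGluing A C :=
    ⟨⟨fun i j => (hCc i j).analyticOn, C, hCb⟩,
      conjugatesToUnitary_of_invariant hA hCc
        (exists_ne_zero_on_circle hC.det (hCdet 0 (by simp))) (hT.union hS) hCinv⟩
  refine ⟨C, hCg, fun C' hC' => ?_⟩
  obtain ⟨F, hF⟩ := hC'.1.2
  obtain ⟨g, -, -, hgF⟩ := uniq C C' C F hCg hC' hCb hF
  obtain ⟨G, hG, hGF⟩ := hF.exists_matAnalytic hC'.1.1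
  have e : ∀ z ∈ unitDisk, G z = F z := fun z hz => hGF (ball_subset_closedBall hz)
  obtain ⟨f, hf, hfG⟩ := exists_scalarFactor hC hG hCdet
    (fun z hz => by rw [e z hz]; exact hF.det_ne_zero z hz) hCne
    (fun z hz => by rw [e z hz]; exact hgF z hz)
  refine ⟨f, hf, fun z hz => ?_⟩
  rw [← hfG z hz, hGF (unitCircle_subset_closedDisk hz), hF.boundary hz]

lemma isGluing_congr {A M : ι → ℂ → Mat2} (h : ∀ k, EqOn (A k) (M k) unitCircle) {C : ℂ → Mat2} :
    IsGluing A C ↔ IsGluing M C := by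
  refine and_congr_right fun _ => forall_congr' fun k => exists_congr fun N =>
    and_congr_right fun _ => forall₂_congr fun z hz => ?_
  rw [h k hz]

end GluingTheorem

theorem mainTheorem2 (n : ℕ) (M : Fin n → ℂ → GluingTheorem.Mat2)
    (hM : ∀ k, GluingTheorem.IsAnalyticLoop (M k))
    (hdet : ∀ k, ∀ z ∈ GluingTheorem.unitCircle, (M k z).det ≠ 0)
    (hnd : ∃ z ∈ GluingTheorem.unitCircle, GluingTheorem.Nondegenerate (fun k => M k z))
    (hunit : {z ∈ GluingTheorem.unitCircle |
      ¬ GluingTheorem.SimultaneouslyUnitarizable (fun k => M k z)}.Finite) :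
    (∃ C : ℂ → GluingTheorem.Mat2, GluingTheorem.IsGluing M C ∧
      ∀ C' : ℂ → GluingTheorem.Mat2, GluingTheorem.IsGluing M C' →
        ∃ f : ℂ → ℂ, GluingTheorem.IsScalarFactor f ∧
          ∀ z ∈ GluingTheorem.unitCircle, C' z = f z • C z) ∧
    (∀ C₁ C₂ F₁ F₂ : ℂ → GluingTheorem.Mat2,
      GluingTheorem.IsGluing M C₁ → GluingTheorem.IsGluing M C₂ →
      GluingTheorem.IsBoundaryOf C₁ F₁ → GluingTheorem.IsBoundaryOf C₂ F₂ →
        ∃ g : ℂ → ℂ, DifferentiableOn ℂ g GluingTheorem.unitDisk ∧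
          (∀ z ∈ GluingTheorem.unitDisk, g z ≠ 0) ∧
          ∀ z ∈ GluingTheorem.unitDisk, F₂ z = g z • F₁ z) := by
  choose A hA hAM using fun k => (hM k).exists_matAnalytic
  have hfam : ∀ z ∈ GluingTheorem.unitCircle, (fun k => A k z) = fun k => M k z :=
    fun z hz => funext fun k => hAM k hz
  simp only [← GluingTheorem.isGluing_congr hAM]
  refine GluingTheorem.gluing_theorem hA (fun k z hz => ?_) ?_ ?_
  · rw [hAM k hz]
    exact hdet k z hz
  · obtain ⟨z, hz, h⟩ := hnd
    exact ⟨z, hz, by rwa [hfam z hz]⟩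
  · refine hunit.subset fun z hz => ⟨hz.1, ?_⟩
    rw [← hfam z hz.1]
    exact hz.2
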